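/- Let $e_{ij}$ be the $3\times 3$ matrix units, $a=e_{21}-e_{12}$, $c=e_{32}-e_{23}$, let $\beta\in\mathbb{R}$, $\beta\neq 0$, and put $$\gamma(t)=\exp(t(a+\beta c))\exp(-t\beta c)\in SO(3),\qquad x(t)=\gamma(t)\,(1,0,0)^T\in S^2,$$ $$m=m(t)=\frac{\sin(t\sqrt{1+\beta^2})}{\sqrt{1+\beta^2}},\qquad n=n(t)=\frac{1-\cos(t\sqrt{1+\beta^2})}{1+\beta^2},$$ where $S^2\subset\mathbb{R}^3$ is the unit sphere. For $t_1\geq 0$ the arc $x(t)$, $0\leq t\leq t_1$, has no self-intersection if and only if $t_1<2\pi/\sqrt{1+\beta^2}$. Assume $0\leq t_1<2\pi/\sqrt{1+\beta^2}$. Then there is a unique shortest segment $[x(0)x(t_1)]$ in $S^2$; let $r=r(t_1)$ be its length. For $t_1>0$ there is a unique lesser curvilinear digon $P$ in $S^2$ bounded by the arc $x(t)$, $0\leq t\leq t_1$, and by $[x(0)x(t_1)]$, that is, the connected component of smaller area of the complement in $S^2$ of these two arcs. $P$ has the same interior angle $\psi=\psi(t_1)$ at both of its vertices; let $S(t_1)$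 be the area of $P$. Then $$r(t_1)=\arccos(1-n(t_1))\qquad\text{for } 0\le t_1<2\pi/\sqrt{1+\beta^2},$$ and for $0<t_1<2\pi/\sqrt{1+\beta^2}$ $$r'(t_1)=\cos\psi(t_1)=\frac{m(t_1)}{\sqrt{n(t_1)(2-n(t_1))}},\qquad S(t_1)=2\psi(t_1)-|\beta|t_1,\qquad S'(t_1)>0.$$ As $t_1\to 0^+$ one has $\psi(t_1)\to 0$ and $S(t_1)\to 0$. Moreover $0<\psi(t_1)\leq\pi/2$ if $0<t_1\leq\pi/\sqrt{1+\beta^2}$, and $\pi/2<\psi(t_1)<\pi$ if $\pi/\sqrt{1+\beta^2}<t_1<2\pi/\sqrt{1+\beta^2}$. -/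

import Mathlib

open Real Set Filter Topology MeasureTheory

/-- Euclidean three-space `E³`. -/
abbrev E3 : Type := EuclideanSpace ℝ (Fin 3)

/-- The unit sphere `S²` as a subset of `E³`. -/
def S2 : Set E3 := Metric.sphere (0 : E3) 1

/-- The matrix `a = e₂₁ - e₁₂` of `so(3)`. -/
def soA : Matrix (Fin 3) (Fin 3) ℝ := !![0, -1, 0; 1, 0, 0; 0, 0, 0]

/-- The matrix `c = e₃₂ - e₂₃` of `so(3)`. -/
def soC : Matrix (Fin 3) (Fin 3) ℝ := !![0, 0, 0; 0, 0, -1; 0, 1, 0]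

/-- The geodesic `γ(t) = exp(t(a + βc)) exp(-tβc)` of `SO(3)`. -/
noncomputable def geo (β t : ℝ) : Matrix (Fin 3) (Fin 3) ℝ :=
  NormedSpace.exp (t • (soA + β • soC)) * NormedSpace.exp (-(t * β) • soC)

/-- The projection `x(t) = γ(t) e₁` of the geodesic to the sphere. -/
noncomputable def projGeo (β t : ℝ) : E3 :=
  WithLp.toLp 2 ((geo β t).mulVec ![1, 0, 0])

/-- `m = sin(t √(1+β²)) / √(1+β²)`. -/
noncomputable def mFun (β t : ℝ) : ℝ := sin (t * √(1 + β ^ 2)) / √(1 + β ^ 2)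

/-- `n = (1 - cos(t √(1+β²))) / (1+β²)`. -/
noncomputable def nFun (β t : ℝ) : ℝ := (1 - cos (t * √(1 + β ^ 2))) / (1 + β ^ 2)

/-- `f` restricted to `[0,1]` is a continuous curve in the sphere from `p` to `q`. -/
def IsSphereCurve (p q : E3) (f : ℝ → E3) : Prop :=
  ContinuousOn f (Icc 0 1) ∧ MapsTo f (Icc 0 1) S2 ∧ f 0 = p ∧ f 1 = q

/-- `K` is a shortest segment of the sphere joining `p` and `q`, and its length is `l`: `K` is the
trace of a curve of length `l` in the sphere, no curve of the sphere from `p` to `q` is shorter. -/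
def IsShortestSegment (p q : E3) (K : Set E3) (l : ℝ) : Prop :=
  0 ≤ l ∧ ∃ f : ℝ → E3, IsSphereCurve p q f ∧ f '' Icc 0 1 = K ∧
    eVariationOn f (Icc 0 1) = ENNReal.ofReal l ∧
    ∀ g : ℝ → E3, IsSphereCurve p q g → eVariationOn f (Icc 0 1) ≤ eVariationOn g (Icc 0 1)

/-- The area (two-dimensional surface measure, of total mass `4π`) of the part of the sphere
that lies in `P`. -/
noncomputable def sphereArea (P : Set E3) : ENNReal :=
  (volume : Measure E3).toSphere ((↑) ⁻¹' P : Set (Metric.sphere (0 : E3) 1))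

/-- `P` is the lesser of the regions of the sphere bounded by the closed curve `C`: it is a
connected component of the complement of `C` in the sphere, its boundary is `C`, and every other
component of the complement has larger area. -/
def IsLesserRegion (C P : Set E3) : Prop :=
  (∃ z ∈ S2 \ C, P = connectedComponentIn (S2 \ C) z) ∧
  closure P \ P = C ∧
  ∀ z ∈ S2 \ C, z ∉ P → sphereArea P < sphereArea (connectedComponentIn (S2 \ C) z)

/-- `P` is the lesser curvilinear digon bounded by the arc `x(t)`, `0 ≤ t ≤ t₁`, and a shortest
segment `[x(0)x(t₁)]`. -/
def IsLesserDigon (β t₁ : ℝ) (P : Set E3) : Prop :=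
  ∃ (K : Set E3) (l : ℝ), IsShortestSegment (projGeo β 0) (projGeo β t₁) K l ∧
    IsLesserRegion (projGeo β '' Icc 0 t₁ ∪ K) P

/-- The region `P` of the sphere has the interior angle `α` at the point `v` of the sphere: the
unit tangent vectors at `v` whose great circle rays start out inside `P` form a set of angular
measure `α` (in the angular coordinate of any orthonormal frame `u, w` of the tangent plane). -/
def HasInteriorAngle (P : Set E3) (v : E3) (α : ℝ) : Prop :=
  0 ≤ α ∧ ∀ u w : E3, Orthonormal ℝ ![v, u, w] →
    volume {θ : ℝ | θ ∈ Ioc (-π) π ∧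
      ∀ᶠ s in 𝓝[>] (0 : ℝ), cos s • v + sin s • (cos θ • u + sin θ • w) ∈ P} = ENNReal.ofReal α

/-! The factor `exp(-tβc)` fixes `(1,0,0)`, so `x(t)` is an orbit of the rotation group
`exp(t(a+βc))`: a small circle run through with angular speed `ω = √(1+β²)`, whose spherical radius
has cosine `c = |β|/ω > 0` and sine `s = 1/ω`. Let `h = t₁ω/2` be half the angle of the arc. In an
orthonormal frame with `b 0` the centre of the circle and `b 1` pointing to the middle of the arc,
with coordinates `z, x, y`, the arc is `z = c`, `x ≥ κ` with `κ = s cos h`, and the plane of the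
chord is `κz = cx`. Hence the digon is `z > c`, `cx > κz` on the sphere (`openDigon`), and every
claim becomes one about this explicit set.

Segment: a curve on the sphere is at least as long as the angle between its ends, and equality
forces it onto the great circle arc (`isShortestSegment_greatCircle_iff`). The end points have inner
product `1 - n`, whence `r`.

Region: the digon is the radial projection of a convex cone, the rest of the complement is a union
of two overlapping connected sets, and open sets separate the two. The antipodal copy of the digon
lies in the outer region and leaves room there, so the digon is the lesser one
(`isLesserRegion_iff`).

Angle: the directions entering the digon at a vertex form the intersection of two half-planes, and
the Gram data of their normals give `cos ψ = κ/(sL)`, where `L² = c² + κ²`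
(`hasInteriorAngle_openDigon`).

Area: Gauss–Bonnet is replaced by a computation. Gnomonic projection turns the digon into a segment
of a disk, and the resulting integral has an elementary primitive, with value `2ψ - 2ch = 2ψ -
|β|t₁` (`sphereArea_openDigon`). Finally `2ψ' = |β|/L²` and `L² = 1 - s² sin² h < 1` give `S' > 0`.
-/

/-! ### Closed form of the curve. -/

section Rodrigues

attribute [local instance] Matrix.linftyOpNormedRing Matrix.linftyOpNormedAlgebra

/-- Rodrigues' formula for a matrix with `A³ = -ω² A`. -/
theorem exp_smul_eq_rodrigues {A : Matrix (Fin 3) (Fin 3) ℝ} {ω : ℝ} (hω : ω ≠ 0)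
    (hA : A * A * A = (-ω ^ 2) • A) (t : ℝ) :
    NormedSpace.exp (t • A) =
      1 + (sin (t * ω) / ω) • A + ((1 - cos (t * ω)) / ω ^ 2) • (A * A) := by
  let R : ℝ → Matrix (Fin 3) (Fin 3) ℝ := fun t =>
    1 + (sin (t * ω) / ω) • A + ((1 - cos (t * ω)) / ω ^ 2) • (A * A)
  have hR : ∀ t, HasDerivAt R (cos (t * ω) • A + (sin (t * ω) / ω) • (A * A)) t := by
    intro t
    have h1 : HasDerivAt (fun t => sin (t * ω) / ω) (cos (t * ω)) t := by
      have := (((hasDerivAt_id t).mul_const ω).sin).div_const ω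
      convert! this using 1
      simp; field_simp
    have h2 : HasDerivAt (fun t => (1 - cos (t * ω)) / ω ^ 2) (sin (t * ω) / ω) t := by
      have := ((((hasDerivAt_id t).mul_const ω).cos).const_sub 1).div_const (ω ^ 2)
      convert! this using 1
      simp; field_simp
    have h3 := ((h1.smul_const A).const_add 1).add (h2.smul_const (A * A))
    exact h3
  -- `A³ = -ω²A` makes `R' = AR`, so `exp(-tA) R(t)` is constant.
  let g : ℝ → Matrix (Fin 3) (Fin 3) ℝ := fun t => NormedSpace.exp (t • (-A)) * R t
  have hg : ∀ t, HasDerivAt g 0 t := by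
    intro t
    have h1 := (hasDerivAt_exp_smul_const (𝕂 := ℝ) (-A) t).mul (hR t)
    convert! h1 using 1
    have : -A * R t + (cos (t * ω) • A + (sin (t * ω) / ω) • (A * A)) = 0 := by
      have h3 : A * (A * A) = (-ω ^ 2) • A := by rw [← mul_assoc, hA]
      simp only [R, neg_mul, mul_add, mul_smul_comm, h3, mul_one]
      match_scalars <;> field_simp <;> ring
    rw [mul_assoc, ← mul_add, this, mul_zero]
  have hconst : g t = g 0 :=
    is_const_of_deriv_eq_zero (fun x => (hg x).differentiableAt) (fun x => (hg x).deriv) t 0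
  have h0 : g 0 = 1 := by simp [g, R]
  have h1 : NormedSpace.exp (t • A) * NormedSpace.exp (t • (-A)) = 1 := by
    rw [← Matrix.exp_add_of_commute]
    · simp
    · exact ((Commute.refl A).neg_right.smul_left t).smul_right t
  calc NormedSpace.exp (t • A) = NormedSpace.exp (t • A) * g t := by rw [hconst, h0, mul_one]
    _ = (NormedSpace.exp (t • A) * NormedSpace.exp (t • (-A))) * R t := by
        simp only [g, mul_assoc]
    _ = R t := by rw [h1, one_mul]

end Rodrigues

theorem projGeo_eq (β t : ℝ) :
    projGeo β t = !₂[1 - nFun β t, mFun β t, β * nFun β t] := by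
  have hpos : 0 < 1 + β ^ 2 := by positivity
  have hω : √(1 + β ^ 2) ≠ 0 := (sqrt_pos.2 hpos).ne'
  have hsq : √(1 + β ^ 2) ^ 2 = 1 + β ^ 2 := sq_sqrt hpos.le
  have hA : soA + β • soC = !![0, -1, 0; 1, 0, -β; 0, β, 0] := by
    ext i j; fin_cases i <;> fin_cases j <;> simp [soA, soC]
  have h1 := exp_smul_eq_rodrigues (A := soA + β • soC) hω (by
    rw [hsq, hA]; ext i j; fin_cases i <;> fin_cases j <;>
      simp [Matrix.mul_apply, Fin.sum_univ_three] <;> first | (left; ring) | ring) t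
  have h2 := exp_smul_eq_rodrigues (A := soC) one_ne_zero (by
    ext i j; fin_cases i <;> fin_cases j <;>
      simp [soC, Matrix.mul_apply, Fin.sum_univ_three]) (-(t * β))
  rw [hsq] at h1
  -- `c` annihilates the first basis vector, so the right factor of `γ` leaves no trace in `x(t)`.
  have h3 : (NormedSpace.exp (-(t * β) • soC)).mulVec ![1, 0, 0] = ![1, 0, 0] := by
    rw [h2]
    ext i; fin_cases i <;>
      simp [soC, Matrix.mulVec, dotProduct, Fin.sum_univ_three]
  rw [projGeo, geo, ← Matrix.mulVec_mulVec, h3, h1, hA]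
  ext i; fin_cases i <;>
    simp [Matrix.mulVec, dotProduct, Fin.sum_univ_three, nFun, mFun] <;> ring

/-! ### Lengths of curves on the sphere and shortest segments. -/

open InnerProductGeometry in
theorem two_mul_sin_half_angle {x y : E3} (hx : ‖x‖ = 1) (hy : ‖y‖ = 1) :
    2 * sin (angle x y / 2) = ‖x - y‖ := by
  have h1 : cos (angle x y) = inner ℝ x y := by
    rw [cos_angle, hx, hy]; simp
  have h2 : ‖x - y‖ ^ 2 = 2 - 2 * cos (angle x y) := by
    rw [norm_sub_sq_real, hx, hy, h1]; ring
  have h3 : 0 ≤ sin (angle x y / 2) :=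
    sin_nonneg_of_nonneg_of_le_pi (by linarith [angle_nonneg x y])
      (by linarith [angle_nonneg x y, angle_le_pi x y])
  have h4 : cos (angle x y) = 1 - 2 * sin (angle x y / 2) ^ 2 := by
    have h := Real.cos_two_mul (angle x y / 2)
    rw [mul_div_cancel₀ _ two_ne_zero] at h
    linarith [sin_sq_add_cos_sq (angle x y / 2)]
  rw [← sq_eq_sq₀ (by positivity) (norm_nonneg _), h2, h4]; ring

-- Half the angle is the arcsine of half the chord, and `arcsin` has derivative 1 at 0. The bound
-- depends on the chord length only, hence is uniform over the sphere.
open InnerProductGeometry in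
theorem exists_angle_le_mul_norm_sub {ε : ℝ} (hε : 0 < ε) :
    ∃ δ > 0, ∀ x y : E3, ‖x‖ = 1 → ‖y‖ = 1 → ‖x - y‖ < δ →
      angle x y ≤ (1 + ε) * ‖x - y‖ := by
  have h := hasDerivAt_arcsin (x := 0) (by norm_num) (by norm_num)
  rw [hasDerivAt_iff_isLittleO] at h
  obtain ⟨δ, hδ, H⟩ := Metric.eventually_nhds_iff.1 (h.def hε)
  refine ⟨δ, hδ, fun x y hx hy hxy => ?_⟩
  have h1 := two_mul_sin_half_angle hx hy
  have h2 : arcsin (‖x - y‖ / 2) = angle x y / 2 := by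
    rw [← h1, mul_div_cancel_left₀ _ two_ne_zero]
    exact arcsin_sin (by linarith [angle_nonneg x y, pi_pos]) (by linarith [angle_le_pi x y])
  have h3 := @H (‖x - y‖ / 2) (by
    rw [dist_zero_right, norm_of_nonneg (by positivity)]
    linarith [norm_nonneg (x - y)])
  simp only [arcsin_zero, sub_zero, ne_eq, OfNat.ofNat_ne_zero, not_false_eq_true, zero_pow,
    sqrt_one, div_one, smul_eq_mul, mul_one, norm_eq_abs, h2] at h3
  rw [abs_of_nonneg (by positivity : 0 ≤ ‖x - y‖ / 2)] at h3
  linarith [le_abs_self (angle x y / 2 - ‖x - y‖ / 2)]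

open InnerProductGeometry in
theorem angle_le_sum_angle (u : ℕ → E3) (hu : ‖u 0‖ = 1) (n : ℕ) :
    angle (u 0) (u n) ≤ ∑ i ∈ Finset.range n, angle (u i) (u (i + 1)) := by
  induction n with
  | zero => simp [angle_self (norm_ne_zero_iff.1 (by rw [hu]; norm_num))]
  | succ n ih =>
    rw [Finset.sum_range_succ]
    linarith [angle_le_angle_add_angle (u 0) (u n) (u (n + 1))]

open InnerProductGeometry in
/-- A curve on the sphere is at least as long as the angle between its end points. -/
theorem ofReal_angle_le_eVariationOn {f : ℝ → E3} {a b : ℝ} (hab : a ≤ b)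
    (hf : ContinuousOn f (Icc a b)) (hn : ∀ t ∈ Icc a b, ‖f t‖ = 1) :
    ENNReal.ofReal (angle (f a) (f b)) ≤ eVariationOn f (Icc a b) := by
  by_cases htop : eVariationOn f (Icc a b) = ⊤
  · rw [htop]; exact le_top
  refine ENNReal.ofReal_le_of_le_toReal ?_
  set V := (eVariationOn f (Icc a b)).toReal with hV
  -- Uniform continuity gives a subdivision so fine that each angle is at most `1 + ε` times its
  -- chord; the chords sum to at most the variation. Then `ε → 0`.
  have key : ∀ ε > 0, angle (f a) (f b) ≤ (1 + ε) * V := by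
    intro ε hε
    obtain ⟨δ, hδ, H⟩ := exists_angle_le_mul_norm_sub hε
    have huc := isCompact_Icc.uniformContinuousOn_of_continuous hf
    obtain ⟨η, hη, Hη⟩ := Metric.uniformContinuousOn_iff.1 huc δ hδ
    obtain ⟨N, hN⟩ := exists_nat_gt ((b - a) / η)
    have hN0 : (0 : ℝ) < N := lt_of_le_of_lt (div_nonneg (by linarith) hη.le) hN
    let u : ℕ → ℝ := fun i => a + i * ((b - a) / N)
    have hstep : 0 ≤ (b - a) / N := div_nonneg (by linarith) hN0.le
    have humono : Monotone u := by
      intro i j hij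
      have : (i : ℝ) ≤ j := by exact_mod_cast hij
      simp only [u]
      gcongr
    have hu0 : u 0 = a := by simp [u]
    have huN : u N = b := by simp only [u]; field_simp; ring
    have hmem : ∀ i ≤ N, u i ∈ Icc a b := fun i hi =>
      ⟨hu0 ▸ humono (Nat.zero_le i), huN ▸ humono hi⟩
    have hsum : ∑ i ∈ Finset.range N, edist (f (u (i + 1))) (f (u i)) ≤
        eVariationOn f (Icc a b) := by
      rw [Finset.range_eq_Ico]
      exact eVariationOn.sum_le_of_monotoneOn_Icc (humono.monotoneOn _)
        (fun i hi => hmem i hi.2)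
    have hsum' : ∑ i ∈ Finset.range N, ‖f (u i) - f (u (i + 1))‖ ≤ V := by
      have := ENNReal.toReal_mono htop hsum
      rw [ENNReal.toReal_sum (fun i _ => edist_ne_top _ _)] at this
      refine le_trans (le_of_eq ?_) this
      refine Finset.sum_congr rfl fun i _ => ?_
      rw [edist_dist, ENNReal.toReal_ofReal dist_nonneg, dist_comm, dist_eq_norm]
    calc angle (f a) (f b) = angle (f (u 0)) (f (u N)) := by rw [hu0, huN]
      _ ≤ ∑ i ∈ Finset.range N, angle (f (u i)) (f (u (i + 1))) :=
        angle_le_sum_angle (fun i => f (u i)) (hn _ (hmem 0 (Nat.zero_le _))) N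
      _ ≤ ∑ i ∈ Finset.range N, (1 + ε) * ‖f (u i) - f (u (i + 1))‖ := by
        refine Finset.sum_le_sum fun i hi => ?_
        have hi' := Finset.mem_range.1 hi
        have m1 := hmem i hi'.le
        have m2 := hmem (i + 1) hi'
        refine H _ _ (hn _ m1) (hn _ m2) ?_
        rw [← dist_eq_norm]
        refine Hη _ m1 _ m2 ?_
        have : u i - u (i + 1) = -((b - a) / N) := by simp only [u]; push_cast; ring
        rw [Real.dist_eq, this, abs_neg, abs_of_nonneg hstep, div_lt_iff₀ hN0]
        rw [div_lt_iff₀ hη] at hN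
        linarith
      _ = (1 + ε) * ∑ i ∈ Finset.range N, ‖f (u i) - f (u (i + 1))‖ := by
        rw [Finset.mul_sum]
      _ ≤ (1 + ε) * V := by gcongr
  have hV0 : 0 ≤ V := ENNReal.toReal_nonneg
  have hlim : Tendsto (fun ε : ℝ => (1 + ε) * V) (𝓝[>] 0) (𝓝 ((1 + 0) * V)) :=
    (Continuous.tendsto (by fun_prop) 0).mono_left nhdsWithin_le_nhds
  rw [add_zero, one_mul] at hlim
  exact ge_of_tendsto hlim (eventually_mem_nhdsWithin.mono fun ε hε => key ε hε)

/-- The unit speed great circle through `k` in the direction `w`. -/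
noncomputable def greatCircle (k w : E3) (σ : ℝ) : E3 := cos σ • k + sin σ • w

theorem continuous_greatCircle (k w : E3) : Continuous (greatCircle k w) := by
  unfold greatCircle; fun_prop

section GreatCircle

variable {k w : E3} (hk : ‖k‖ = 1) (hw : ‖w‖ = 1) (hkw : inner ℝ k w = 0)
include hk hw hkw

theorem inner_greatCircle (σ τ : ℝ) :
    inner ℝ (greatCircle k w σ) (greatCircle k w τ) = cos (σ - τ) := by
  have hwk : inner ℝ w k = 0 := by rw [real_inner_comm, hkw]
  simp only [greatCircle, inner_add_left, inner_add_right, real_inner_smul_left,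
    real_inner_smul_right, real_inner_self_eq_norm_sq, hk, hw, hkw, hwk]
  rw [cos_sub]; ring

theorem norm_greatCircle (σ : ℝ) : ‖greatCircle k w σ‖ = 1 := by
  have h := inner_greatCircle hk hw hkw σ σ
  rw [real_inner_self_eq_norm_sq, sub_self, cos_zero] at h
  nlinarith [norm_nonneg (greatCircle k w σ)]

open InnerProductGeometry in
theorem angle_greatCircle {σ τ : ℝ} (h : |σ - τ| ≤ π) :
    angle (greatCircle k w σ) (greatCircle k w τ) = |σ - τ| := by
  rw [angle, inner_greatCircle hk hw hkw, norm_greatCircle hk hw hkw,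
    norm_greatCircle hk hw hkw, mul_one, div_one, ← cos_abs, arccos_cos (abs_nonneg _) h]

theorem dist_greatCircle_le (σ τ : ℝ) :
    dist (greatCircle k w σ) (greatCircle k w τ) ≤ |σ - τ| := by
  rw [dist_eq_norm, ← sq_le_sq₀ (norm_nonneg _) (abs_nonneg _), sq_abs, norm_sub_sq_real,
    inner_greatCircle hk hw hkw, norm_greatCircle hk hw hkw, norm_greatCircle hk hw hkw]
  linarith [one_sub_sq_div_two_le_cos (x := σ - τ)]

open InnerProductGeometry in
/-- Equality in the triangle inequality for angles forces a point onto the great circle arc. -/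
theorem eq_greatCircle_of_angle_add_angle {d : ℝ} (hd0 : 0 ≤ d) (hd : d < π / 2) {y : E3}
    (hy : ‖y‖ = 1)
    (h : angle (greatCircle k w (-d)) y + angle y (greatCircle k w d) = 2 * d) :
    y = greatCircle k w (-d + angle (greatCircle k w (-d)) y) := by
  set α := angle (greatCircle k w (-d)) y with hα
  set z := greatCircle k w (-d + α) with hz
  have hα0 : 0 ≤ α := angle_nonneg _ _
  have hny := norm_greatCircle hk hw hkw
  have e1 : inner ℝ (greatCircle k w (-d)) y = cos α := by
    rw [hα, cos_angle, hny, hy]; simp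
  have e2 : inner ℝ (greatCircle k w d) y = cos (2 * d - α) := by
    have : angle y (greatCircle k w d) = 2 * d - α := by linarith
    rw [← this, cos_angle, hny, hy, real_inner_comm]; simp
  have e3 : inner ℝ (greatCircle k w (-d)) z = cos α := by
    rw [hz, inner_greatCircle hk hw hkw]
    rw [show -d - (-d + α) = -α by ring, cos_neg]
  have e4 : inner ℝ (greatCircle k w d) z = cos (2 * d - α) := by
    rw [hz, inner_greatCircle hk hw hkw]
    congr 1; ring
  -- `y` and the candidate `z` have the same inner products with both end points, so `y - z` is
  -- orthogonal to the plane they span, which contains `z`. Pythagoras with `‖y‖ = ‖z‖ = 1` then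
  -- gives `y = z`.
  have f1 : inner ℝ (greatCircle k w (-d)) (y - z) = 0 := by rw [inner_sub_right, e1, e3, sub_self]
  have f2 : inner ℝ (greatCircle k w d) (y - z) = 0 := by rw [inner_sub_right, e2, e4, sub_self]
  have hcos : 0 < cos d := cos_pos_of_mem_Ioo ⟨by linarith [pi_pos], hd⟩
  simp only [greatCircle, inner_add_left, real_inner_smul_left, cos_neg, sin_neg] at f1 f2
  have g1 : inner ℝ k (y - z) = 0 := by
    have : 2 * cos d * inner ℝ k (y - z) = 0 := by linarith
    simpa [hcos.ne'] using this
  -- The factor `sin (-d + α)` covers `d = 0`, where the end points coincide and carry no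
  -- information about the direction `w`.
  have g3 : sin (-d + α) * inner ℝ w (y - z) = 0 := by
    rcases hd0.eq_or_lt with h0 | h0
    · have : α = 0 := by linarith [angle_nonneg y (greatCircle k w d)]
      simp [this, ← h0]
    · have hsin : 0 < sin d := sin_pos_of_pos_of_lt_pi h0 (by linarith [pi_pos])
      have : 2 * sin d * inner ℝ w (y - z) = 0 := by linarith
      simp only [mul_eq_zero, OfNat.ofNat_ne_zero, hsin.ne', or_self, false_or] at this
      rw [this, mul_zero]
  have g2 : inner ℝ z (y - z) = 0 := by
    have : inner ℝ z (y - z) =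
        cos (-d + α) * inner ℝ k (y - z) + sin (-d + α) * inner ℝ w (y - z) := by
      rw [← real_inner_smul_left, ← real_inner_smul_left, ← inner_add_left]; rfl
    rw [this, g1, g3]; simp
  have hnorm : ‖y‖ ^ 2 = ‖z‖ ^ 2 + ‖y - z‖ ^ 2 := by
    have : y = z + (y - z) := by abel
    conv_lhs => rw [this]
    rw [norm_add_sq_real, g2]; ring
  rw [hy, hny] at hnorm
  have : ‖y - z‖ = 0 := by
    have : ‖y - z‖ ^ 2 = 0 := by linarith
    simpa using this
  exact sub_eq_zero.1 (norm_eq_zero.1 this)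

/-- The competitor that attains the lower bound. An upper bound for its length suffices, as the
lower one holds for every curve. -/
theorem exists_greatCircle_param {d : ℝ} (hd0 : 0 ≤ d) :
    ∃ f : ℝ → E3, IsSphereCurve (greatCircle k w (-d)) (greatCircle k w d) f ∧
      f '' Icc 0 1 = greatCircle k w '' Icc (-d) d ∧
      eVariationOn f (Icc 0 1) ≤ ENNReal.ofReal (2 * d) := by
  let φ : ℝ → ℝ := fun s => -d + s * (2 * d)
  have hφ : MonotoneOn φ (Icc 0 1) := by
    intro s _ t _ hst
    simp only [φ]
    gcongr
  refine ⟨fun s => greatCircle k w (φ s), ⟨?_, ?_, ?_, ?_⟩, ?_, ?_⟩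
  · exact ((continuous_greatCircle k w).comp (by fun_prop)).continuousOn
  · intro s _
    simp [S2, norm_greatCircle hk hw hkw]
  · simp [φ]
  · simp only [φ]; congr 1; ring
  · have : φ '' Icc 0 1 = Icc (-d) d := by
      ext σ
      constructor
      · rintro ⟨s, ⟨h0, h1⟩, rfl⟩
        simp only [φ]
        constructor <;> nlinarith
      · rintro ⟨h1, h2⟩
        rcases hd0.eq_or_lt with h0 | h0
        · exact ⟨0, by simp, by simp only [φ]; linarith⟩
        · refine ⟨(σ + d) / (2 * d), ⟨by apply div_nonneg <;> linarith, ?_⟩, ?_⟩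
          · rw [div_le_one (by linarith)]; linarith
          · simp only [φ]; field_simp; ring
    rw [← this, image_image]
  · have hlip : LipschitzOnWith 1 (greatCircle k w) univ :=
      LipschitzOnWith.of_dist_le_mul fun σ _ τ _ => by
        simpa [Real.dist_eq] using dist_greatCircle_le hk hw hkw σ τ
    have h1 := hlip.comp_eVariationOn_le (g := φ) (s := Icc 0 1) (mapsTo_univ _ _)
    refine h1.trans ?_
    have h2 := hφ.eVariationOn_eq (a := 0) (b := 1) (by simp) (by simp)
    rw [inter_self] at h2
    simp only [ENNReal.coe_one, one_mul]
    refine h2.le.trans (ENNReal.ofReal_le_ofReal ?_)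
    simp [φ]

open InnerProductGeometry in
/-- Two points of the sphere that are not antipodal are joined by exactly one shortest segment,
the arc of a great circle. -/
theorem isShortestSegment_greatCircle_iff {d : ℝ} (hd0 : 0 ≤ d) (hd : d < π / 2)
    {K : Set E3} {l : ℝ} :
    IsShortestSegment (greatCircle k w (-d)) (greatCircle k w d) K l ↔
      K = greatCircle k w '' Icc (-d) d ∧ l = 2 * d := by
  have hang : angle (greatCircle k w (-d)) (greatCircle k w d) = 2 * d := by
    have h : |-d - d| = 2 * d := by
      rw [show -d - d = -(2 * d) by ring, abs_neg, abs_of_nonneg (by linarith)]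
    rw [angle_greatCircle hk hw hkw (by rw [h]; linarith), h]
  have hlow : ∀ g : ℝ → E3, IsSphereCurve (greatCircle k w (-d)) (greatCircle k w d) g →
      ENNReal.ofReal (2 * d) ≤ eVariationOn g (Icc 0 1) := by
    rintro g ⟨hc, hm, h0, h1⟩
    have := ofReal_angle_le_eVariationOn zero_le_one hc
      (fun t ht => by simpa [S2] using hm ht)
    rwa [h0, h1, hang] at this
  obtain ⟨F, hF, hFim, hFv⟩ := exists_greatCircle_param hk hw hkw hd0
  constructor
  · rintro ⟨hl, f, hf, rfl, hfl, hmin⟩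
    have hv : eVariationOn f (Icc 0 1) = ENNReal.ofReal (2 * d) :=
      le_antisymm ((hmin F hF).trans hFv) (hlow f hf)
    have hl2 : l = 2 * d := by
      rw [hfl] at hv
      exact (ENNReal.ofReal_eq_ofReal_iff hl (by linarith)).1 hv
    obtain ⟨hc, hm, h0, h1⟩ := hf
    have hn : ∀ t ∈ Icc (0 : ℝ) 1, ‖f t‖ = 1 := fun t ht => by simpa [S2] using hm ht
    -- Splitting a minimal curve at `t` splits its length additively, so the triangle inequality for
    -- angles is an equality at each of its points.
    have hsum : ∀ t ∈ Icc (0 : ℝ) 1,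
        angle (greatCircle k w (-d)) (f t) + angle (f t) (greatCircle k w d) = 2 * d := by
      intro t ht
      refine le_antisymm ?_ (hang ▸ angle_le_angle_add_angle _ _ _)
      have s0 : Icc (0 : ℝ) t ⊆ Icc 0 1 := Icc_subset_Icc le_rfl ht.2
      have s1 : Icc t (1 : ℝ) ⊆ Icc 0 1 := Icc_subset_Icc ht.1 le_rfl
      have v0 := ofReal_angle_le_eVariationOn ht.1 (hc.mono s0) (fun x hx => hn x (s0 hx))
      have v1 := ofReal_angle_le_eVariationOn ht.2 (hc.mono s1) (fun x hx => hn x (s1 hx))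
      have v2 := eVariationOn.Icc_add_Icc f ht.1 ht.2 (mem_univ t)
      simp only [univ_inter] at v2
      rw [h0] at v0
      rw [h1] at v1
      have v3 := add_le_add v0 v1
      rw [v2, hv, ← ENNReal.ofReal_add (angle_nonneg _ _) (angle_nonneg _ _)] at v3
      exact (ENNReal.ofReal_le_ofReal_iff (by linarith)).1 v3
    have heq : ∀ t ∈ Icc (0 : ℝ) 1,
        f t = greatCircle k w (-d + angle (greatCircle k w (-d)) (f t)) := fun t ht =>
      eq_greatCircle_of_angle_add_angle hk hw hkw hd0 hd (hn t ht) (hsum t ht)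
    refine ⟨?_, hl2⟩
    ext y
    constructor
    · rintro ⟨t, ht, rfl⟩
      refine ⟨_, ⟨?_, ?_⟩, (heq t ht).symm⟩
      · linarith [angle_nonneg (greatCircle k w (-d)) (f t)]
      · linarith [hsum t ht, angle_nonneg (f t) (greatCircle k w d)]
    · rintro ⟨σ, hσ, rfl⟩
      -- No point of the arc is missed: the angle from the start varies continuously from `0` to
      -- `2d` along the curve and determines the point.
      have hcont : ContinuousOn (fun t => angle (greatCircle k w (-d)) (f t)) (Icc 0 1) := by
        unfold angle
        refine continuous_arccos.comp_continuousOn (ContinuousOn.div ?_ ?_ ?_)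
        · exact continuousOn_const.inner hc
        · exact continuousOn_const.mul hc.norm
        · intro t ht
          rw [hn t ht, norm_greatCircle hk hw hkw]; norm_num
      have hsub := intermediate_value_Icc zero_le_one hcont
      have hne : greatCircle k w (-d) ≠ 0 :=
        norm_ne_zero_iff.1 (by rw [norm_greatCircle hk hw hkw]; norm_num)
      rw [h0, h1, hang, angle_self hne] at hsub
      obtain ⟨t, ht, hte⟩ := hsub (show σ + d ∈ Icc 0 (2 * d) from
        ⟨by linarith [hσ.1], by linarith [hσ.2]⟩)
      refine ⟨t, ht, ?_⟩
      simp only at hte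
      rw [heq t ht, hte]; congr 1; ring
  · rintro ⟨rfl, rfl⟩
    have hv := le_antisymm hFv (hlow F hF)
    exact ⟨by linarith, F, hF, hFim, hv, fun g hg => hv ▸ hlow g hg⟩

end GreatCircle

/-! ### The digon and its boundary in an adapted frame. -/

/-- Polar coordinates in the plane. -/
theorem exists_polar (x y : ℝ) : ∃ φ ∈ Ioc (-π) π,
    x = √(x ^ 2 + y ^ 2) * cos φ ∧ y = √(x ^ 2 + y ^ 2) * sin φ := by
  have hn : ‖(⟨x, y⟩ : ℂ)‖ = √(x ^ 2 + y ^ 2) := by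
    rw [Complex.norm_def, Complex.normSq_mk]; congr 1; ring
  refine ⟨Complex.arg ⟨x, y⟩, Complex.arg_mem_Ioc _, ?_, ?_⟩
  · rw [← hn, Complex.norm_mul_cos_arg]
  · rw [← hn, Complex.norm_mul_sin_arg]

/-- The intersection of the convex cone over a spherical cap with a half-space. -/
def digonCone (b : OrthonormalBasis (Fin 3) ℝ E3) (c κ : ℝ) : Set E3 :=
  {y | c * ‖y‖ < inner ℝ (b 0) y ∧ κ * inner ℝ (b 0) y < c * inner ℝ (b 1) y}

/-- The part of an open spherical cap on one side of a great circle. -/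
def openDigon (b : OrthonormalBasis (Fin 3) ℝ E3) (c κ : ℝ) : Set E3 :=
  {y | ‖y‖ = 1 ∧ c < inner ℝ (b 0) y ∧ κ * inner ℝ (b 0) y < c * inner ℝ (b 1) y}

/-- The part of a closed spherical cap on one side of a great circle. -/
def closedDigon (b : OrthonormalBasis (Fin 3) ℝ E3) (c κ : ℝ) : Set E3 :=
  {y | ‖y‖ = 1 ∧ c ≤ inner ℝ (b 0) y ∧ κ * inner ℝ (b 0) y ≤ c * inner ℝ (b 1) y}

/-- The part of the sphere outside of a closed digon. -/
def outerDigon (b : OrthonormalBasis (Fin 3) ℝ E3) (c κ : ℝ) : Set E3 :=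
  {y | ‖y‖ = 1 ∧ (inner ℝ (b 0) y < c ∨ c * inner ℝ (b 1) y < κ * inner ℝ (b 0) y)}

/-- The segment of a great circle cut out by a spherical cap. -/
def capChord (b : OrthonormalBasis (Fin 3) ℝ E3) (c κ : ℝ) : Set E3 :=
  {y | ‖y‖ = 1 ∧ c ≤ inner ℝ (b 0) y ∧ κ * inner ℝ (b 0) y = c * inner ℝ (b 1) y}

/-- The circle of spherical radius `arccos c = arcsin s` about `b 0`. -/
noncomputable def smallCircle (b : OrthonormalBasis (Fin 3) ℝ E3) (c s φ : ℝ) : E3 :=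
  c • b 0 + s • (cos φ • b 1 + sin φ • b 2)

section Coordinates

variable (b : OrthonormalBasis (Fin 3) ℝ E3)

theorem inner_basis_eq (i j : Fin 3) : inner ℝ (b i) (b j) = if i = j then (1 : ℝ) else 0 :=
  orthonormal_iff_ite.1 b.orthonormal i j

theorem norm_sq_eq_coord (y : E3) :
    ‖y‖ ^ 2 = inner ℝ (b 0) y ^ 2 + inner ℝ (b 1) y ^ 2 + inner ℝ (b 2) y ^ 2 := by
  have := b.sum_sq_norm_inner_right y
  simp only [Fin.sum_univ_three, norm_eq_abs, sq_abs] at this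
  exact this.symm

theorem eq_coord (y : E3) :
    y = inner ℝ (b 0) y • b 0 + inner ℝ (b 1) y • b 1 + inner ℝ (b 2) y • b 2 := by
  have := b.sum_repr' y
  rw [Fin.sum_univ_three] at this
  exact this.symm

theorem inner_coord_zero (z x y : ℝ) : inner ℝ (b 0) (z • b 0 + x • b 1 + y • b 2) = z := by
  simp [inner_add_right, real_inner_smul_right]

theorem inner_coord_one (z x y : ℝ) : inner ℝ (b 1) (z • b 0 + x • b 1 + y • b 2) = x := by
  simp [inner_add_right, real_inner_smul_right]

theorem inner_coord_two (z x y : ℝ) : inner ℝ (b 2) (z • b 0 + x • b 1 + y • b 2) = y := by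
  simp [inner_add_right, real_inner_smul_right]

theorem norm_sq_coord (z x y : ℝ) :
    ‖z • b 0 + x • b 1 + y • b 2‖ ^ 2 = z ^ 2 + x ^ 2 + y ^ 2 := by
  rw [norm_sq_eq_coord b, inner_coord_zero, inner_coord_one, inner_coord_two]

theorem smallCircle_eq (c s φ : ℝ) :
    smallCircle b c s φ = c • b 0 + (s * cos φ) • b 1 + (s * sin φ) • b 2 := by
  simp only [smallCircle, smul_add, smul_smul, add_assoc]

end Coordinates

/-! ### Boundary of the digon and components of its complement. -/

section Topology

variable (b : OrthonormalBasis (Fin 3) ℝ E3) {c s κ : ℝ}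

theorem isClosed_closedDigon : IsClosed (closedDigon b c κ) := by
  unfold closedDigon
  simp only [ofPred_and]
  refine (isClosed_eq (by fun_prop) (by fun_prop)).inter
    ((isClosed_le (by fun_prop) (by fun_prop)).inter (isClosed_le (by fun_prop) (by fun_prop)))

/-- Homogenising the cap condition to `c‖y‖ < z` gives a convex condition because `c > 0`. The digon
is the radial projection of this cone, hence connected. -/
theorem convex_digonCone (hc : 0 < c) : Convex ℝ (digonCone b c κ) := by
  intro y hy z hz p q hp hq hpq
  simp only [digonCone, mem_ofPred_eq, inner_add_right, real_inner_smul_right] at *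
  have hn : ‖p • y + q • z‖ ≤ p * ‖y‖ + q * ‖z‖ := by
    refine (norm_add_le _ _).trans ?_
    rw [norm_smul, norm_smul, norm_of_nonneg hp, norm_of_nonneg hq]
  have hn' := mul_le_mul_of_nonneg_left hn hc.le
  rcases hp.eq_or_lt with h | h
  · have : q = 1 := by linarith
    subst this; subst h
    simp only [zero_smul, one_smul, zero_add, zero_mul, one_mul] at *
    exact hz
  · constructor
    · nlinarith [mul_lt_mul_of_pos_left hy.1 h, mul_le_mul_of_nonneg_left hz.1.le hq]
    · nlinarith [mul_lt_mul_of_pos_left hy.2 h, mul_le_mul_of_nonneg_left hz.2.le hq]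

theorem ne_zero_of_mem_digonCone {y : E3} (hy : y ∈ digonCone b c κ) : y ≠ 0 := by
  rintro rfl
  simp [digonCone] at hy

theorem norm_inv_smul {y : E3} (hy : y ≠ 0) : ‖‖y‖⁻¹ • y‖ = 1 := by
  rw [norm_smul, norm_inv, norm_norm, inv_mul_cancel₀ (norm_ne_zero_iff.2 hy)]

theorem continuousAt_normalize {y : E3} (hy : y ≠ 0) :
    ContinuousAt (fun y : E3 => ‖y‖⁻¹ • y) y :=
  (continuous_norm.continuousAt.inv₀ (norm_ne_zero_iff.2 hy)).smul continuousAt_id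

theorem openDigon_eq_image : openDigon b c κ = (fun y => ‖y‖⁻¹ • y) '' digonCone b c κ := by
  ext y
  constructor
  · rintro ⟨h1, h2, h3⟩
    exact ⟨y, ⟨by rwa [h1, mul_one], h3⟩, by simp [h1]⟩
  · rintro ⟨y, hy, rfl⟩
    have h0 := ne_zero_of_mem_digonCone b hy
    have hn : 0 < ‖y‖⁻¹ := inv_pos.2 (norm_pos_iff.2 h0)
    refine ⟨norm_inv_smul h0, ?_, ?_⟩
    · rw [real_inner_smul_right]
      have := mul_lt_mul_of_pos_left hy.1 hn
      rwa [mul_comm c, ← mul_assoc, inv_mul_cancel₀ (norm_ne_zero_iff.2 h0), one_mul] at this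
    · rw [real_inner_smul_right, real_inner_smul_right]
      have := mul_lt_mul_of_pos_left hy.2 hn
      linarith

theorem isPreconnected_openDigon (hc : 0 < c) : IsPreconnected (openDigon b c κ) := by
  rw [openDigon_eq_image]
  exact (convex_digonCone b hc).isPreconnected.image _ fun y hy =>
    (continuousAt_normalize (ne_zero_of_mem_digonCone b hy)).continuousWithinAt

theorem digonCone_nonempty (hc : 0 < c) (hs : 0 < s) (hcs : c ^ 2 + s ^ 2 = 1)
    (hκ : κ ∈ Ioo (-s) s) : (digonCone b c κ).Nonempty := by
  -- Twice the point of the plane `z = c` midway between the chord (`x = κ`) and the circle (`x =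
  -- s`); that point lies inside the unit ball.
  refine ⟨(2 * c) • b 0 + (s + κ) • b 1 + (0 : ℝ) • b 2, ?_, ?_⟩
  · rw [inner_coord_zero]
    have h1 : ‖(2 * c) • b 0 + (s + κ) • b 1 + (0 : ℝ) • b 2‖ < 2 := by
      rw [← sq_lt_sq₀ (norm_nonneg _) zero_le_two, norm_sq_coord]
      nlinarith [hκ.1, hκ.2]
    nlinarith
  · rw [inner_coord_zero, inner_coord_one]
    nlinarith [hκ.2]

/-- Moving a point of the closed digon along a straight segment towards a point of the open cone
makes both inequalities strict at once; normalising returns to the sphere. -/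
theorem closure_openDigon (hc : 0 < c) (hs : 0 < s) (hcs : c ^ 2 + s ^ 2 = 1)
    (hκ : κ ∈ Ioo (-s) s) : closure (openDigon b c κ) = closedDigon b c κ := by
  refine subset_antisymm (closure_minimal ?_ (isClosed_closedDigon b)) ?_
  · rintro y ⟨h1, h2, h3⟩
    exact ⟨h1, h2.le, h3.le⟩
  rintro y ⟨h1, h2, h3⟩
  obtain ⟨o, ho⟩ := digonCone_nonempty b hc hs hcs hκ
  have hy0 : y ≠ 0 := norm_ne_zero_iff.1 (by rw [h1]; norm_num)
  have hyc : y ∈ closure (digonCone b c κ) := by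
    have ht : Tendsto (fun ε : ℝ => (1 - ε) • y + ε • o) (𝓝[>] 0)
        (𝓝 ((1 - (0 : ℝ)) • y + (0 : ℝ) • o)) :=
      (Continuous.tendsto (by fun_prop) 0).mono_left nhdsWithin_le_nhds
    simp only [sub_zero, one_smul, zero_smul, add_zero] at ht
    refine mem_closure_of_tendsto ht ?_
    filter_upwards [Ioo_mem_nhdsGT one_pos] with ε hε
    have hn : ‖(1 - ε) • y + ε • o‖ ≤ (1 - ε) * 1 + ε * ‖o‖ := by
      refine (norm_add_le _ _).trans ?_
      rw [norm_smul, norm_smul, norm_of_nonneg (by linarith [hε.2]), norm_of_nonneg hε.1.le, h1]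
    have hn' := mul_le_mul_of_nonneg_left hn hc.le
    have hε' : 0 ≤ 1 - ε := by linarith [hε.2]
    simp only [digonCone, mem_ofPred_eq, inner_add_right, real_inner_smul_right] at *
    constructor
    · nlinarith [mul_lt_mul_of_pos_left ho.1 hε.1, mul_le_mul_of_nonneg_left h2 hε']
    · nlinarith [mul_lt_mul_of_pos_left ho.2 hε.1, mul_le_mul_of_nonneg_left h3 hε']
  rw [openDigon_eq_image]
  have := mem_closure_image (continuousAt_normalize hy0) hyc
  simpa [h1] using this

/-- For `c > 0` this cap exceeds a hemisphere and is no projection of a convex cone; instead it is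
the image of a convex set of pairs (height, longitude). -/
theorem isPreconnected_cap (c : ℝ) : IsPreconnected {y : E3 | ‖y‖ = 1 ∧ inner ℝ (b 0) y < c} := by
  let f : ℝ × ℝ → E3 := fun p =>
    p.1 • b 0 + (√(1 - p.1 ^ 2) * cos p.2) • b 1 + (√(1 - p.1 ^ 2) * sin p.2) • b 2
  have himg : {y : E3 | ‖y‖ = 1 ∧ inner ℝ (b 0) y < c} =
      f '' ((Icc (-1) 1 ∩ Iio c) ×ˢ univ) := by
    ext y
    constructor
    · rintro ⟨h1, h2⟩
      have hn := norm_sq_eq_coord b y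
      rw [h1] at hn
      obtain ⟨φ, -, e1, e2⟩ := exists_polar (inner ℝ (b 1) y) (inner ℝ (b 2) y)
      have : inner ℝ (b 1) y ^ 2 + inner ℝ (b 2) y ^ 2 = 1 - inner ℝ (b 0) y ^ 2 := by linarith
      rw [this] at e1 e2
      refine ⟨(inner ℝ (b 0) y, φ), ⟨⟨?_, h2⟩, mem_univ _⟩, ?_⟩
      · constructor <;> nlinarith [sq_nonneg (inner ℝ (b 1) y), sq_nonneg (inner ℝ (b 2) y)]
      · simp only [f]
        rw [← e1, ← e2]
        exact (eq_coord b y).symm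
    · rintro ⟨⟨z, φ⟩, ⟨⟨⟨h1, h2⟩, h3⟩, -⟩, rfl⟩
      refine ⟨?_, ?_⟩
      · have h4 : 0 ≤ 1 - z ^ 2 := by nlinarith
        have : ‖f (z, φ)‖ ^ 2 = 1 := by
          simp only [f]
          rw [norm_sq_coord, mul_pow, mul_pow, sq_sqrt h4]
          nlinarith [sin_sq_add_cos_sq φ]
        nlinarith [norm_nonneg (f (z, φ))]
      · simp only [f]
        rw [inner_coord_zero]
        exact h3
  rw [himg]
  refine IsPreconnected.image ?_ _ (Continuous.continuousOn (by fun_prop))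
  exact (((convex_Icc (-1 : ℝ) 1).inter (convex_Iio c)).prod convex_univ).isPreconnected

theorem isPreconnected_hemisphere (c κ : ℝ) :
    IsPreconnected {y : E3 | ‖y‖ = 1 ∧ c * inner ℝ (b 1) y < κ * inner ℝ (b 0) y} := by
  let H : Set E3 := {y | c * inner ℝ (b 1) y < κ * inner ℝ (b 0) y}
  have h0 : ∀ y ∈ H, y ≠ 0 := by
    rintro y hy rfl
    simp [H] at hy
  have himg : {y : E3 | ‖y‖ = 1 ∧ c * inner ℝ (b 1) y < κ * inner ℝ (b 0) y} =
      (fun y => ‖y‖⁻¹ • y) '' H := by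
    ext y
    constructor
    · rintro ⟨h1, h2⟩
      exact ⟨y, h2, by simp [h1]⟩
    · rintro ⟨y, hy, rfl⟩
      refine ⟨norm_inv_smul (h0 y hy), ?_⟩
      have hn : 0 < ‖y‖⁻¹ := inv_pos.2 (norm_pos_iff.2 (h0 y hy))
      have := mul_lt_mul_of_pos_left hy hn
      rw [real_inner_smul_right, real_inner_smul_right]
      linarith
  have hconv : Convex ℝ H := by
    have h := convex_halfSpace_lt (𝕜 := ℝ)
      (f := fun y : E3 => c * inner ℝ (b 1) y - κ * inner ℝ (b 0) y)
      ⟨fun x y => by simp only [inner_add_right]; ring,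
        fun a x => by simp only [real_inner_smul_right, smul_eq_mul]; ring⟩ 0
    simpa only [sub_neg] using h
  rw [himg]
  exact hconv.isPreconnected.image _ fun y hy =>
    (continuousAt_normalize (h0 y hy)).continuousWithinAt

/-- The outer region is a cap united with an open hemisphere, and `-b 1` lies in both. -/
theorem isPreconnected_outerDigon (hc : 0 < c) : IsPreconnected (outerDigon b c κ) := by
  have : outerDigon b c κ = {y : E3 | ‖y‖ = 1 ∧ inner ℝ (b 0) y < c} ∪
      {y : E3 | ‖y‖ = 1 ∧ c * inner ℝ (b 1) y < κ * inner ℝ (b 0) y} := by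
    ext y; simp only [outerDigon, mem_ofPred_eq, mem_union]; tauto
  rw [this]
  refine IsPreconnected.union (-b 1) ?_ ?_ (isPreconnected_cap b c) (isPreconnected_hemisphere b c κ)
  · simp [hc]
  · simp [hc]

theorem smallCircle_image_eq (hs : 0 < s) (hcs : c ^ 2 + s ^ 2 = 1) {h : ℝ} (h0 : 0 ≤ h)
    (hπ : h < π) :
    smallCircle b c s '' Icc (-h) h =
      {y | ‖y‖ = 1 ∧ inner ℝ (b 0) y = c ∧ s * cos h ≤ inner ℝ (b 1) y} := by
  ext y
  constructor
  · rintro ⟨φ, hφ, rfl⟩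
    rw [smallCircle_eq]
    refine ⟨?_, inner_coord_zero b _ _ _, ?_⟩
    · have : ‖c • b 0 + (s * cos φ) • b 1 + (s * sin φ) • b 2‖ ^ 2 = 1 := by
        rw [norm_sq_coord]; nlinarith [sin_sq_add_cos_sq φ]
      nlinarith [norm_nonneg (c • b 0 + (s * cos φ) • b 1 + (s * sin φ) • b 2)]
    · rw [inner_coord_one, ← cos_abs φ]
      gcongr
      exact cos_le_cos_of_nonneg_of_le_pi (abs_nonneg _) hπ.le (abs_le.2 hφ)
  · rintro ⟨h1, h2, h3⟩
    have hn := norm_sq_eq_coord b y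
    obtain ⟨φ, hφ, e1, e2⟩ := exists_polar (inner ℝ (b 1) y) (inner ℝ (b 2) y)
    have : inner ℝ (b 1) y ^ 2 + inner ℝ (b 2) y ^ 2 = s ^ 2 := by
      rw [h1, h2] at hn; linarith
    rw [this, sqrt_sq hs.le] at e1 e2
    refine ⟨φ, ?_, ?_⟩
    · rw [mem_Icc, ← abs_le]
      by_contra! hlt
      have hφπ : |φ| ≤ π := abs_le.2 ⟨hφ.1.le, hφ.2⟩
      have := cos_lt_cos_of_nonneg_of_le_pi h0 hφπ hlt
      rw [cos_abs] at this
      rw [e1] at h3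
      exact absurd h3 (not_le.2 (by gcongr))
    · rw [smallCircle_eq, ← e1, ← e2, ← h2]
      exact (eq_coord b y).symm

theorem mul_cos_mem_Ioo (hs : 0 < s) {h : ℝ} (h0 : 0 < h) (hπ : h < π) :
    s * cos h ∈ Ioo (-s) s := by
  have h1 := cos_lt_cos_of_nonneg_of_le_pi le_rfl hπ.le h0
  have h2 := cos_lt_cos_of_nonneg_of_le_pi h0.le le_rfl hπ
  rw [cos_zero] at h1
  rw [cos_pi] at h2
  constructor <;> nlinarith

/-- A boundary point turns one of the two inequalities into an equality: `z = c` reduces the other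
to `κ ≤ x` and gives the arc, while equality in the second gives the chord. -/
theorem smallCircle_union_capChord (hc : 0 < c) (hs : 0 < s) (hcs : c ^ 2 + s ^ 2 = 1) {h : ℝ}
    (h0 : 0 ≤ h) (hπ : h < π) :
    smallCircle b c s '' Icc (-h) h ∪ capChord b c (s * cos h) =
      closedDigon b c (s * cos h) \ openDigon b c (s * cos h) := by
  rw [smallCircle_image_eq b hs hcs h0 hπ]
  ext y
  simp only [capChord, closedDigon, openDigon, mem_union, Set.mem_sdiff, mem_ofPred_eq, not_and, not_lt]
  constructor
  · rintro (⟨h1, h2, h3⟩ | ⟨h1, h2, h3⟩)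
    · refine ⟨⟨h1, h2.ge, ?_⟩, fun _ hlt => absurd hlt (by rw [h2]; exact lt_irrefl _)⟩
      rw [h2, mul_comm]
      gcongr
    · exact ⟨⟨h1, h2, h3.le⟩, fun _ _ => h3.ge⟩
  · rintro ⟨⟨h1, h2, h3⟩, h4⟩
    rcases h2.eq_or_lt with h5 | h5
    · refine Or.inl ⟨h1, h5.symm, ?_⟩
      rw [← h5, mul_comm] at h3
      exact le_of_mul_le_mul_left h3 hc
    · exact Or.inr ⟨h1, h2, le_antisymm h3 (h4 h1 h5)⟩

theorem openDigon_subset_closedDigon : openDigon b c κ ⊆ closedDigon b c κ :=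
  fun _ ⟨h1, h2, h3⟩ => ⟨h1, h2.le, h3.le⟩

theorem outerDigon_eq : outerDigon b c κ = S2 \ closedDigon b c κ := by
  ext y
  simp only [outerDigon, closedDigon, S2, Set.mem_sdiff, mem_ofPred_eq, mem_sphere_zero_iff_norm,
    not_and, not_le]
  constructor
  · rintro ⟨h1, h2 | h2⟩
    · exact ⟨h1, fun _ h => absurd h (not_le.2 h2)⟩
    · exact ⟨h1, fun _ _ => h2⟩
  · rintro ⟨h1, h2⟩
    exact ⟨h1, (lt_or_ge _ _).imp id (h2 h1)⟩

theorem openDigon_union_outerDigon :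
    S2 \ (closedDigon b c κ \ openDigon b c κ) = openDigon b c κ ∪ outerDigon b c κ := by
  have h1 := openDigon_subset_closedDigon b (c := c) (κ := κ)
  have h2 : openDigon b c κ ⊆ S2 := fun y hy => mem_sphere_zero_iff_norm.2 hy.1
  rw [outerDigon_eq]
  ext y
  constructor
  · rintro ⟨h3, h4⟩
    by_cases h : y ∈ closedDigon b c κ
    · exact Or.inl (by_contra fun h5 => h4 ⟨h, h5⟩)
    · exact Or.inr ⟨h3, h⟩
  · rintro (h | h)
    · exact ⟨h2 h, fun h' => h'.2 h⟩
    · exact ⟨h.1, fun h' => h.2 h'.1⟩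

theorem exists_disjoint_isOpen (c κ : ℝ) : ∃ U V : Set E3, IsOpen U ∧ IsOpen V ∧ Disjoint U V ∧
    openDigon b c κ ⊆ U ∧ outerDigon b c κ ⊆ V := by
  refine ⟨{y | c < inner ℝ (b 0) y} ∩ {y | κ * inner ℝ (b 0) y < c * inner ℝ (b 1) y},
    {y | inner ℝ (b 0) y < c} ∪ {y | c * inner ℝ (b 1) y < κ * inner ℝ (b 0) y}, ?_, ?_, ?_, ?_, ?_⟩
  · exact (isOpen_lt (by fun_prop) (by fun_prop)).inter (isOpen_lt (by fun_prop) (by fun_prop))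
  · exact (isOpen_lt (by fun_prop) (by fun_prop)).union (isOpen_lt (by fun_prop) (by fun_prop))
  · rw [Set.disjoint_left]
    simp only [mem_inter_iff, mem_union, mem_ofPred_eq]
    rintro y ⟨h1, h2⟩ (h3 | h3) <;> linarith
  · exact fun y hy => ⟨hy.2.1, hy.2.2⟩
  · exact fun y hy => hy.2

/-- Two preconnected sets separated by open sets are the components of their union. -/
theorem connectedComponentIn_union_eq_left {A B U V : Set E3} (hA : IsPreconnected A)
    (hU : IsOpen U) (hV : IsOpen V) (hUV : Disjoint U V) (hAU : A ⊆ U) (hBV : B ⊆ V) {z : E3}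
    (hz : z ∈ A) : connectedComponentIn (A ∪ B) z = A := by
  refine subset_antisymm ?_ (hA.subset_connectedComponentIn hz subset_union_left)
  have hsub := connectedComponentIn_subset (A ∪ B) z
  have := isPreconnected_connectedComponentIn.subset_left_of_subset_union hU hV hUV
    (hsub.trans (union_subset_union hAU hBV))
    ⟨z, mem_connectedComponentIn (Or.inl hz), hAU hz⟩
  intro y hy
  exact (hsub hy).resolve_right fun hB => Set.disjoint_left.1 hUV (this hy) (hBV hB)

theorem connectedComponentIn_openDigon (hc : 0 < c) {z : E3} (hz : z ∈ openDigon b c κ) :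
    connectedComponentIn (S2 \ (closedDigon b c κ \ openDigon b c κ)) z = openDigon b c κ := by
  obtain ⟨U, V, hU, hV, hUV, h1, h2⟩ := exists_disjoint_isOpen b c κ
  rw [openDigon_union_outerDigon]
  exact connectedComponentIn_union_eq_left (isPreconnected_openDigon b hc) hU hV hUV h1 h2 hz

theorem connectedComponentIn_outerDigon (hc : 0 < c) {z : E3} (hz : z ∈ outerDigon b c κ) :
    connectedComponentIn (S2 \ (closedDigon b c κ \ openDigon b c κ)) z = outerDigon b c κ := by
  obtain ⟨U, V, hU, hV, hUV, h1, h2⟩ := exists_disjoint_isOpen b c κ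
  rw [openDigon_union_outerDigon, union_comm]
  exact connectedComponentIn_union_eq_left (isPreconnected_outerDigon b hc) hV hU hUV.symm h2 h1 hz

end Topology

/-! ### The digon has the smaller area. -/

section Area

open scoped Pointwise

theorem sphereArea_eq {P : Set E3} (hP : MeasurableSet P) :
    sphereArea P = 3 * volume (Ioo (0 : ℝ) 1 • (P ∩ Metric.sphere 0 1)) := by
  rw [sphereArea, Measure.toSphere_apply' _ (measurable_subtype_coe hP),
    Subtype.image_preimage_coe, inter_comm]
  simp

theorem sphereArea_neg {P : Set E3} (hP : MeasurableSet P) : sphereArea (-P) = sphereArea P := by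
  rw [sphereArea_eq hP, sphereArea_eq hP.neg, ← Measure.measure_neg volume (_ • _)]
  congr 2
  ext y
  simp only [Set.mem_neg, Set.mem_smul, mem_inter_iff, mem_sphere_zero_iff_norm]
  constructor
  · rintro ⟨r, hr, x, ⟨hx, hn⟩, e⟩
    exact ⟨r, hr, -x, ⟨hx, by rwa [norm_neg]⟩, by rw [smul_neg, e, neg_neg]⟩
  · rintro ⟨r, hr, x, ⟨hx, hn⟩, e⟩
    exact ⟨r, hr, -x, ⟨by rwa [neg_neg], by rwa [norm_neg]⟩, by rw [smul_neg, e]⟩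

variable (b : OrthonormalBasis (Fin 3) ℝ E3) {c s κ : ℝ}

theorem measurableSet_openDigon : MeasurableSet (openDigon b c κ) := by
  unfold openDigon
  simp only [ofPred_and]
  exact (measurableSet_eq_fun (by fun_prop) (by fun_prop)).inter
    ((measurableSet_lt (by fun_prop) (by fun_prop)).inter
      (measurableSet_lt (by fun_prop) (by fun_prop)))

/-- No area is computed: the antipodal copy of the digon lies in `z < -c`, and the belt `|z| < c`,
which has positive area, is disjoint from it. Both lie in the outer region. -/
theorem sphereArea_openDigon_lt (hc : 0 < c) :
    sphereArea (openDigon b c κ) < sphereArea (outerDigon b c κ) := by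
  let Z : Set (Metric.sphere (0 : E3) 1) :=
    {y | -c < inner ℝ (b 0) (y : E3)} ∩ {y | inner ℝ (b 0) (y : E3) < c}
  have hZo : IsOpen Z :=
    (isOpen_lt (by fun_prop) (by fun_prop)).inter (isOpen_lt (by fun_prop) (by fun_prop))
  have hZ : (volume : Measure E3).toSphere Z ≠ 0 :=
    (hZo.measure_pos _ ⟨⟨b 1, by simp⟩, by simp [Z, hc]⟩).ne'
  have hfin : sphereArea (openDigon b c κ) ≠ ⊤ := measure_ne_top _ _
  calc sphereArea (openDigon b c κ)
      < sphereArea (openDigon b c κ) + (volume : Measure E3).toSphere Z :=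
        ENNReal.lt_add_right hfin hZ
    _ = sphereArea (-openDigon b c κ) + (volume : Measure E3).toSphere Z := by
        rw [sphereArea_neg (measurableSet_openDigon b)]
    _ = (volume : Measure E3).toSphere ((↑) ⁻¹' (-openDigon b c κ) ∪ Z) := by
        rw [sphereArea, measure_union _ hZo.measurableSet]
        rw [Set.disjoint_left]
        rintro y ⟨-, h2, -⟩ ⟨h3, -⟩
        simp only [inner_neg_right, mem_ofPred_eq] at h2 h3
        linarith
    _ ≤ sphereArea (outerDigon b c κ) := by
        refine measure_mono ?_
        rintro y (⟨-, h2, -⟩ | ⟨-, h3⟩)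
        · refine ⟨by simp, Or.inl ?_⟩
          simp only [inner_neg_right] at h2
          linarith
        · exact ⟨by simp, Or.inl h3⟩

/-- Of the two components of the complement of the boundary of a digon, the digon is the lesser. -/
theorem isLesserRegion_iff (hc : 0 < c) (hs : 0 < s) (hcs : c ^ 2 + s ^ 2 = 1)
    (hκ : κ ∈ Ioo (-s) s) {P : Set E3} :
    IsLesserRegion (closedDigon b c κ \ openDigon b c κ) P ↔ P = openDigon b c κ := by
  have hne : (openDigon b c κ).Nonempty := by
    rw [openDigon_eq_image]; exact (digonCone_nonempty b hc hs hcs hκ).image _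
  have hlt := sphereArea_openDigon_lt b (κ := κ) hc
  have hdisj : ∀ z ∈ openDigon b c κ, z ∉ outerDigon b c κ := by
    intro z hz hz'
    rw [outerDigon_eq] at hz'
    exact hz'.2 (openDigon_subset_closedDigon b hz)
  constructor
  · rintro ⟨⟨z, hz, rfl⟩, -, hmin⟩
    rw [openDigon_union_outerDigon] at hz
    rcases hz with hz | hz
    · exact connectedComponentIn_openDigon b hc hz
    · rw [connectedComponentIn_outerDigon b hc hz] at hmin
      obtain ⟨w, hw⟩ := hne
      have := hmin w (by rw [openDigon_union_outerDigon]; exact Or.inl hw) (hdisj w hw)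
      rw [connectedComponentIn_openDigon b hc hw] at this
      exact absurd this hlt.asymm
  · rintro rfl
    obtain ⟨w, hw⟩ := hne
    refine ⟨⟨w, by rw [openDigon_union_outerDigon]; exact Or.inl hw,
      (connectedComponentIn_openDigon b hc hw).symm⟩, by rw [closure_openDigon b hc hs hcs hκ], ?_⟩
    intro z hz hzP
    rw [openDigon_union_outerDigon] at hz
    rw [connectedComponentIn_outerDigon b hc (hz.resolve_left hzP)]
    exact hlt

end Area

/-! ### One-variable integrals for the area. -/

section Integrals

/-- Only continuity is asked at the end points, since the `arccos` terms of the primitive used below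
are not differentiable at `s / c`; the sign of `f` supplies integrability. -/
theorem lintegral_Ioo_eq_of_hasDerivAt {F f : ℝ → ℝ} {a b : ℝ} (hab : a ≤ b)
    (hc : ContinuousOn F (Icc a b)) (hd : ∀ x ∈ Ioo a b, HasDerivAt F (f x) x)
    (hn : ∀ x ∈ Ioo a b, 0 ≤ f x) :
    ∫⁻ x in Ioo a b, ENNReal.ofReal (f x) = ENNReal.ofReal (F b - F a) := by
  have hint : IntegrableOn f (Ioc a b) :=
    intervalIntegral.integrableOn_deriv_of_nonneg hc hd hn
  rw [← intervalIntegral.integral_eq_sub_of_hasDerivAt_of_le hab hc hd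
    ((intervalIntegrable_iff_integrableOn_Ioc_of_le hab).2 hint),
    intervalIntegral.integral_of_le hab, integral_Ioc_eq_integral_Ioo]
  exact (ofReal_integral_eq_lintegral_ofReal (hint.mono_set Ioo_subset_Ioc_self)
    ((ae_restrict_iff' measurableSet_Ioo).2 (Eventually.of_forall hn))).symm

theorem lintegral_sq_Ioo {ρ : ℝ} (hρ : 0 ≤ ρ) :
    ∫⁻ z in Ioo 0 ρ, ENNReal.ofReal (z ^ 2) = ENNReal.ofReal (ρ ^ 3 / 3) := by
  rw [lintegral_Ioo_eq_of_hasDerivAt (F := fun z => z ^ 3 / 3) hρ (by fun_prop) _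
    (fun x _ => by positivity)]
  · simp
  · intro x _
    have := (hasDerivAt_pow 3 x).div_const 3
    convert! this using 1
    simp

theorem hasDerivAt_div_mul_sqrt {A : ℝ} (hA : 0 < A) (y : ℝ) :
    HasDerivAt (fun y => y / (A * √(A + y ^ 2))) ((1 / √(A + y ^ 2)) ^ 3) y := by
  have hpos : 0 < A + y ^ 2 := by positivity
  have hs : 0 < √(A + y ^ 2) := sqrt_pos.2 hpos
  have h1 : HasDerivAt (fun y : ℝ => A + y ^ 2) (2 * y) y := by
    simpa using (hasDerivAt_pow 2 y).const_add A
  have h2 := (hasDerivAt_id y).div ((h1.sqrt hpos.ne').const_mul A) (by positivity)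
  convert! h2 using 1
  have hsq : √(A + y ^ 2) ^ 2 = A + y ^ 2 := sq_sqrt hpos.le
  simp only [id]
  field_simp
  rw [hsq]; ring

theorem lintegral_density_Ioo {A R : ℝ} (hA : 0 < A) (hR : 0 ≤ R) :
    ∫⁻ y in Ioo (-R) R, ENNReal.ofReal ((1 / √(A + y ^ 2)) ^ 3 / 3) =
      ENNReal.ofReal (2 * R / (3 * A * √(A + R ^ 2))) := by
  rw [lintegral_Ioo_eq_of_hasDerivAt (F := fun y => y / (A * √(A + y ^ 2)) / 3) (by linarith) _
    (fun x _ => (hasDerivAt_div_mul_sqrt hA x).div_const 3) (fun x _ => by positivity)]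
  · congr 1
    have : 0 < √(A + R ^ 2) := sqrt_pos.2 (by positivity)
    rw [neg_sq]; field_simp; ring
  · exact fun x _ =>
      ((hasDerivAt_div_mul_sqrt hA x).div_const 3).continuousAt.continuousWithinAt

theorem continuous_gnomonic_area {s : ℝ} (hs : 0 < s) (c : ℝ) :
    Continuous (fun X => 2 * arccos (X / (s * √(1 + X ^ 2))) - 2 * c * arccos (X / (s / c))) := by
  have h1 : Continuous fun X : ℝ => X / (s * √(1 + X ^ 2)) :=
    continuous_id.div (by fun_prop) fun X => by positivity
  exact (continuous_const.mul (continuous_arccos.comp h1)).sub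
    (continuous_const.mul (continuous_arccos.comp (by fun_prop)))

variable {c s : ℝ} (hc : 0 < c) (hs : 0 < s) (hcs : c ^ 2 + s ^ 2 = 1)
include hc hs hcs

/-- At `X = κ/c` this function is the interior angle of the digon, so the formula serves both the
area integral and the derivative of `ψ`. It is explicit because `c² + s² = 1` makes one minus the
square of the argument a perfect square. -/
theorem hasDerivAt_arccos_gnomonic {X : ℝ} (hX : X ^ 2 < (s / c) ^ 2) :
    HasDerivAt (fun X => arccos (X / (s * √(1 + X ^ 2))))
      (-(1 / (c * √((s / c) ^ 2 - X ^ 2) * (1 + X ^ 2)))) X := by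
  have hpos : 0 < 1 + X ^ 2 := by positivity
  have hq : 0 < √(1 + X ^ 2) := sqrt_pos.2 hpos
  have hqsq : √(1 + X ^ 2) ^ 2 = 1 + X ^ 2 := sq_sqrt hpos.le
  have hR0 : 0 < (s / c) ^ 2 - X ^ 2 := by linarith
  have hR : 0 < √((s / c) ^ 2 - X ^ 2) := sqrt_pos.2 hR0
  have hRsq : √((s / c) ^ 2 - X ^ 2) ^ 2 = (s / c) ^ 2 - X ^ 2 := sq_sqrt hR0.le
  have h1 : HasDerivAt (fun X : ℝ => 1 + X ^ 2) (2 * X) X := by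
    simpa using (hasDerivAt_pow 2 X).const_add 1
  have h2 := (hasDerivAt_id X).div ((h1.sqrt hpos.ne').const_mul s) (by positivity)
  have key : 1 - (X / (s * √(1 + X ^ 2))) ^ 2 =
      (c * √((s / c) ^ 2 - X ^ 2) / (s * √(1 + X ^ 2))) ^ 2 := by
    rw [div_pow, div_pow, mul_pow, mul_pow, hqsq, hRsq]
    field_simp
    linear_combination (X ^ 2) * hcs
  have hlt : (X / (s * √(1 + X ^ 2))) ^ 2 < 1 := by
    have : 0 < (c * √((s / c) ^ 2 - X ^ 2) / (s * √(1 + X ^ 2))) ^ 2 := by positivity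
    linarith
  have hne1 : X / (s * √(1 + X ^ 2)) ≠ 1 := fun h => by rw [h] at hlt; norm_num at hlt
  have hne2 : X / (s * √(1 + X ^ 2)) ≠ -1 := fun h => by rw [h] at hlt; norm_num at hlt
  have h3 := (hasDerivAt_arccos hne2 hne1).comp X h2
  convert! h3 using 1
  rw [key, sqrt_sq (by positivity)]
  simp only [id]
  field_simp
  rw [hqsq]; ring

/-- The area of the digon bounded by a circle of radius `arctan (s / c)` and the chord at gnomonic
distance `X` from its centre. -/
theorem hasDerivAt_gnomonic_area {X : ℝ} (hX : X ^ 2 < (s / c) ^ 2) :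
    HasDerivAt (fun X => 2 * arccos (X / (s * √(1 + X ^ 2))) - 2 * c * arccos (X / (s / c)))
      (-(2 * c * √((s / c) ^ 2 - X ^ 2) / (1 + X ^ 2))) X := by
  have hpos : 0 < 1 + X ^ 2 := by positivity
  have hT : 0 < s / c := by positivity
  have hR0 : 0 < (s / c) ^ 2 - X ^ 2 := by linarith
  have hR : 0 < √((s / c) ^ 2 - X ^ 2) := sqrt_pos.2 hR0
  have hRsq : √((s / c) ^ 2 - X ^ 2) ^ 2 = (s / c) ^ 2 - X ^ 2 := sq_sqrt hR0.le
  have hlt : (X / (s / c)) ^ 2 < 1 := by rw [div_pow, div_lt_one (by positivity)]; exact hX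
  have hne1 : X / (s / c) ≠ 1 := fun h => by rw [h] at hlt; norm_num at hlt
  have hne2 : X / (s / c) ≠ -1 := fun h => by rw [h] at hlt; norm_num at hlt
  have h2 : HasDerivAt (fun X => arccos (X / (s / c))) (-(1 / √((s / c) ^ 2 - X ^ 2))) X := by
    have h3 := (hasDerivAt_arccos hne2 hne1).comp X ((hasDerivAt_id X).div_const (s / c))
    convert! h3 using 1
    have : 1 - (X / (s / c)) ^ 2 = (√((s / c) ^ 2 - X ^ 2) / (s / c)) ^ 2 := by
      rw [div_pow X, div_pow (√_), hRsq]; field_simp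
    rw [this, sqrt_sq (by positivity)]
    generalize √((s / c) ^ 2 - X ^ 2) = R at hR ⊢
    field_simp
  have h4 := ((hasDerivAt_arccos_gnomonic hc hs hcs hX).const_mul 2).sub (h2.const_mul (2 * c))
  convert! h4 using 1
  have hs2 : s ^ 2 = 1 - c ^ 2 := by linarith
  have h5 : √((s / c) ^ 2 - X ^ 2) ^ 2 * c ^ 2 = 1 - c ^ 2 * (1 + X ^ 2) := by
    rw [hRsq]; field_simp; linarith
  generalize √((s / c) ^ 2 - X ^ 2) = R at hR h5 ⊢
  field_simp
  linear_combination (-1) * h5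

theorem lintegral_gnomonic_area {X₀ : ℝ} (hX : X₀ ∈ Ioo (-(s / c)) (s / c)) :
    ∫⁻ X in Ioo X₀ (s / c), ENNReal.ofReal (2 * c * √((s / c) ^ 2 - X ^ 2) / (1 + X ^ 2) / 3) =
      ENNReal.ofReal
        ((2 * arccos (X₀ / (s * √(1 + X₀ ^ 2))) - 2 * c * arccos (X₀ / (s / c))) / 3) := by
  have hT : 0 < s / c := by positivity
  rw [lintegral_Ioo_eq_of_hasDerivAt (F := fun X => -((2 * arccos (X / (s * √(1 + X ^ 2))) -
    2 * c * arccos (X / (s / c))) / 3)) hX.2.le]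
  · congr 1
    -- At the upper end both arccosines have argument 1, so the primitive vanishes there.
    have h1 : √(1 + (s / c) ^ 2) = 1 / c := by
      rw [sqrt_eq_iff_mul_self_eq (by positivity) (by positivity)]
      field_simp; linarith
    have h2 : s / c / (s * √(1 + (s / c) ^ 2)) = 1 := by rw [h1]; field_simp
    have h3 : s / c / (s / c) = 1 := div_self hT.ne'
    simp only [h2, h3, arccos_one]
    ring
  · exact ((continuous_gnomonic_area hs c).div_const 3).neg.continuousOn
  · intro X h
    have h1 : X ^ 2 < (s / c) ^ 2 := sq_lt_sq' (by linarith [h.1, hX.1]) h.2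
    have := ((hasDerivAt_gnomonic_area hc hs hcs h1).div_const 3).neg
    convert! this using 1
    ring
  · intro X _
    positivity

end Integrals

/-! ### Area of the digon by gnomonic projection. -/

section Cone

open scoped Pointwise

/-- The gnomonic image of a digon: a segment of a disk. -/
def diskSegment (c κ : ℝ) : Set (ℝ × ℝ) :=
  {p | c ^ 2 * (1 + p.1 ^ 2 + p.2 ^ 2) < 1 ∧ κ < c * p.1}

/-- The part in the unit ball of the cone over a disk segment at height one. -/
def coneRegion (c κ : ℝ) : Set (ℝ × ℝ × ℝ) :=
  {q | 0 < q.1 ∧ q.1 ^ 2 + q.2.1 ^ 2 + q.2.2 ^ 2 < 1 ∧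
    c ^ 2 * (q.1 ^ 2 + q.2.1 ^ 2 + q.2.2 ^ 2) < q.1 ^ 2 ∧ κ * q.1 < c * q.2.1}

theorem measurableSet_diskSegment (c κ : ℝ) : MeasurableSet (diskSegment c κ) := by
  unfold diskSegment
  simp only [ofPred_and]
  exact (measurableSet_lt (by fun_prop) (by fun_prop)).inter
    (measurableSet_lt (by fun_prop) (by fun_prop))

theorem measurableSet_coneRegion (c κ : ℝ) : MeasurableSet (coneRegion c κ) := by
  unfold coneRegion
  simp only [ofPred_and]
  exact (measurableSet_lt (by fun_prop) (by fun_prop)).inter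
    ((measurableSet_lt (by fun_prop) (by fun_prop)).inter
    ((measurableSet_lt (by fun_prop) (by fun_prop)).inter
    (measurableSet_lt (by fun_prop) (by fun_prop))))

theorem measurePreserving_coord (b : OrthonormalBasis (Fin 3) ℝ E3) :
    MeasurePreserving (fun y : E3 => (inner ℝ (b 0) y, inner ℝ (b 1) y, inner ℝ (b 2) y))
      volume (volume : Measure (ℝ × ℝ × ℝ)) := by
  have h1 := b.measurePreserving_repr
  have h2 := (EuclideanSpace.volume_preserving_symm_measurableEquiv_toLp (Fin 3)).comp h1
  have h3 := (volume_preserving_piFinSuccAbove (fun _ : Fin 3 => ℝ) 0).comp h2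
  have h4 := ((MeasurePreserving.id (volume : Measure ℝ)).prod (volume_preserving_finTwoArrow ℝ)).comp h3
  convert! h4 using 1
  ext y <;> simp [MeasurableEquiv.piFinSuccAbove, OrthonormalBasis.repr_apply_apply,
    MeasurableEquiv.finTwoArrow, Fin.tail]

theorem sphereArea_openDigon_eq_volume (b : OrthonormalBasis (Fin 3) ℝ E3) {c : ℝ} (κ : ℝ)
    (hc : 0 < c) : sphereArea (openDigon b c κ) = 3 * volume (coneRegion c κ) := by
  rw [sphereArea_eq (measurableSet_openDigon b), ← (measurePreserving_coord b).measure_preimage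
    (measurableSet_coneRegion c κ).nullMeasurableSet]
  congr 2
  ext y
  simp only [Set.mem_smul, mem_inter_iff, mem_sphere_zero_iff_norm, mem_preimage, coneRegion,
    mem_ofPred_eq, ← norm_sq_eq_coord b y]
  constructor
  · rintro ⟨r, hr, x, ⟨⟨h1, h2, h3⟩, -⟩, rfl⟩
    have hr0 := hr.1
    have hr1 := hr.2
    simp only [real_inner_smul_right, norm_smul, h1, norm_of_nonneg hr.1.le, mul_one]
    refine ⟨mul_pos hr0 (hc.trans h2), by nlinarith, ?_, by nlinarith⟩
    rw [← mul_pow, sq_lt_sq₀ (by positivity) (mul_pos hr0 (hc.trans h2)).le, mul_comm]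
    gcongr
  · rintro ⟨h1, h2, h3, h4⟩
    have hy : y ≠ 0 := by rintro rfl; simp at h1
    have hn : 0 < ‖y‖ := norm_pos_iff.2 hy
    have h5 : ‖‖y‖⁻¹ • y‖ = 1 := norm_inv_smul hy
    refine ⟨‖y‖, ⟨hn, by nlinarith⟩, ‖y‖⁻¹ • y, ⟨⟨h5, ?_, ?_⟩, h5⟩, ?_⟩
    · rw [real_inner_smul_right, inv_mul_eq_div, lt_div_iff₀ hn]
      rw [← mul_pow, sq_lt_sq₀ (by positivity) h1.le] at h3
      exact h3
    · rw [real_inner_smul_right, real_inner_smul_right]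
      have := mul_lt_mul_of_pos_left h4 (inv_pos.2 hn)
      linarith
    · rw [smul_smul, mul_inv_cancel₀ hn.ne', one_smul]

/-- The slice at height `z` is `z` times a subset of the disk segment, whence the factor `z²`. -/
theorem volume_slice_coneRegion (c κ : ℝ) {z : ℝ} (hz : 0 < z) :
    volume (Prod.mk z ⁻¹' coneRegion c κ) = ENNReal.ofReal (z ^ 2) *
      volume {p : ℝ × ℝ | p ∈ diskSegment c κ ∧ z ^ 2 * (1 + p.1 ^ 2 + p.2 ^ 2) < 1} := by
  have : Prod.mk z ⁻¹' coneRegion c κ =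
      z • {p : ℝ × ℝ | p ∈ diskSegment c κ ∧ z ^ 2 * (1 + p.1 ^ 2 + p.2 ^ 2) < 1} := by
    ext ⟨x, y⟩
    rw [mem_smul_set_iff_inv_smul_mem₀ hz.ne']
    simp only [mem_preimage, coneRegion, diskSegment, mem_ofPred_eq, Prod.smul_mk, smul_eq_mul, hz,
      true_and]
    have e : z ^ 2 * (1 + (z⁻¹ * x) ^ 2 + (z⁻¹ * y) ^ 2) = z ^ 2 + x ^ 2 + y ^ 2 := by
      field_simp
    have e2 : c ^ 2 * (1 + (z⁻¹ * x) ^ 2 + (z⁻¹ * y) ^ 2) < 1 ↔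
        c ^ 2 * (z ^ 2 + x ^ 2 + y ^ 2) < z ^ 2 := by
      rw [← e, ← mul_lt_mul_iff_right₀ (pow_pos hz 2)]
      ring_nf
    have e3 : κ < c * (z⁻¹ * x) ↔ κ * z < c * x := by
      rw [← mul_lt_mul_iff_left₀ hz]
      have : c * (z⁻¹ * x) * z = c * x := by field_simp
      rw [this]
    rw [e, e2, e3]
    tauto
  rw [this, Measure.addHaar_smul]
  simp [Module.finrank_prod]

/-- After exchanging the integrals, a point `p` of the segment contributes the heights `0 < z <
1/√(1+|p|²)` at which the ray through `(1, p)` is still in the unit ball, and `∫ z² dz` over them is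
the density. -/
theorem volume_coneRegion (c κ : ℝ) :
    volume (coneRegion c κ) = ∫⁻ p in diskSegment c κ,
      ENNReal.ofReal ((1 / √(1 + p.1 ^ 2 + p.2 ^ 2)) ^ 3 / 3) := by
  let G : Set (ℝ × ℝ × ℝ) := {q | 0 < q.1 ∧ q.2 ∈ diskSegment c κ ∧
    q.1 ^ 2 * (1 + q.2.1 ^ 2 + q.2.2 ^ 2) < 1}
  have hG : MeasurableSet G := by
    simp only [G, ofPred_and]
    exact (measurableSet_lt (by fun_prop) (by fun_prop)).inter
      ((measurable_snd (measurableSet_diskSegment c κ)).inter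
        (measurableSet_lt (by fun_prop) (by fun_prop)))
  let f : ℝ → ℝ × ℝ → ENNReal := fun z p =>
    G.indicator (fun q => ENNReal.ofReal (q.1 ^ 2)) (z, p)
  have hf : Measurable (Function.uncurry f) := by
    have : Measurable (fun q : ℝ × ℝ × ℝ => ENNReal.ofReal (q.1 ^ 2)) := by fun_prop
    exact this.indicator hG
  have h1 : volume (coneRegion c κ) = ∫⁻ z, ∫⁻ p, f z p := by
    rw [Measure.volume_eq_prod, Measure.prod_apply (measurableSet_coneRegion c κ)]
    refine lintegral_congr fun z => ?_
    rcases le_or_gt z 0 with hz | hz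
    · have e1 : Prod.mk z ⁻¹' coneRegion c κ = ∅ := by
        ext p; simp [coneRegion, hz.not_gt]
      have e2 : ∀ p, f z p = 0 := fun p =>
        indicator_of_notMem (fun h => hz.not_gt h.1) _
      rw [e1]; simp [e2]
    · rw [volume_slice_coneRegion c κ hz]
      have e2 : ∀ p, f z p = {p : ℝ × ℝ | p ∈ diskSegment c κ ∧
          z ^ 2 * (1 + p.1 ^ 2 + p.2 ^ 2) < 1}.indicator (fun _ => ENNReal.ofReal (z ^ 2)) p := by
        intro p
        have : (z, p) ∈ G ↔ p ∈ {p : ℝ × ℝ | p ∈ diskSegment c κ ∧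
            z ^ 2 * (1 + p.1 ^ 2 + p.2 ^ 2) < 1} := by
          simp only [G, mem_ofPred_eq, hz, true_and]
        by_cases h : (z, p) ∈ G
        · simp only [f]
          rw [indicator_of_mem h, indicator_of_mem (this.1 h)]
        · simp only [f]
          rw [indicator_of_notMem h, indicator_of_notMem (fun h' => h (this.2 h'))]
      simp only [e2]
      rw [lintegral_indicator_const]
      simp only [ofPred_and]
      exact (measurableSet_diskSegment c κ).inter (measurableSet_lt (by fun_prop) (by fun_prop))
  rw [h1, lintegral_lintegral_swap hf.aemeasurable, ← lintegral_indicator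
    (measurableSet_diskSegment c κ)]
  refine lintegral_congr fun p => ?_
  by_cases hp : p ∈ diskSegment c κ
  · rw [indicator_of_mem hp]
    have hpos : 0 < 1 + p.1 ^ 2 + p.2 ^ 2 := by positivity
    have hs := sqrt_pos.2 hpos
    rw [← lintegral_sq_Ioo (by positivity), ← lintegral_indicator measurableSet_Ioo]
    refine lintegral_congr fun z => ?_
    have : (z, p) ∈ G ↔ z ∈ Ioo 0 (1 / √(1 + p.1 ^ 2 + p.2 ^ 2)) := by
      simp only [G, mem_ofPred_eq, hp, true_and, mem_Ioo]
      refine and_congr_right fun hz => ?_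
      rw [lt_div_iff₀ hs, ← sq_lt_one_iff₀ (a := z * _) (by positivity), mul_pow, sq_sqrt hpos.le]
    simp only [f, indicator, this]
  · rw [indicator_of_notMem hp]
    have : ∀ z, f z p = 0 := fun z => indicator_of_notMem (fun h => hp h.2.1) _
    simp [this]

/-- The disk has radius `s/c`. Its chord at abscissa `X` has half-length `R` with `1 + X² + R² =
1/c²`, which removes the square root from the inner integral. -/
theorem lintegral_diskSegment {c s κ : ℝ} (hc : 0 < c) (hs : 0 < s) (hcs : c ^ 2 + s ^ 2 = 1)
    (hκ : κ ∈ Ioo (-s) s) :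
    ∫⁻ p in diskSegment c κ, ENNReal.ofReal ((1 / √(1 + p.1 ^ 2 + p.2 ^ 2)) ^ 3 / 3) =
      ∫⁻ X in Ioo (κ / c) (s / c),
        ENNReal.ofReal (2 * c * √((s / c) ^ 2 - X ^ 2) / (1 + X ^ 2) / 3) := by
  rw [← lintegral_indicator (measurableSet_diskSegment c κ), Measure.volume_eq_prod,
    lintegral_prod _ ((Measurable.indicator (by fun_prop)
      (measurableSet_diskSegment c κ)).aemeasurable), ← lintegral_indicator measurableSet_Ioo]
  refine lintegral_congr fun X => ?_
  by_cases hX : X ∈ Ioo (κ / c) (s / c)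
  · rw [indicator_of_mem hX]
    have hXs : X ^ 2 < (s / c) ^ 2 := by
      refine sq_lt_sq' (lt_of_le_of_lt ?_ hX.1) hX.2
      rw [← neg_div]
      exact div_le_div_of_nonneg_right hκ.1.le hc.le
    have hR0 : 0 < (s / c) ^ 2 - X ^ 2 := by linarith
    set R := √((s / c) ^ 2 - X ^ 2) with hR
    have hRsq : R ^ 2 = (s / c) ^ 2 - X ^ 2 := sq_sqrt hR0.le
    have hcRsq : c ^ 2 * (1 + X ^ 2 + R ^ 2) = 1 := by
      rw [hRsq]; field_simp; linarith
    have h1 : √(1 + X ^ 2 + R ^ 2) = 1 / c := by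
      rw [sqrt_eq_iff_mul_self_eq (by positivity) (by positivity)]
      field_simp; linarith
    have h2 := lintegral_density_Ioo (A := 1 + X ^ 2) (R := R) (by positivity) (sqrt_nonneg _)
    have h3 : 2 * R / (3 * (1 + X ^ 2) * √(1 + X ^ 2 + R ^ 2)) = 2 * c * R / (1 + X ^ 2) / 3 := by
      rw [h1]; field_simp
    rw [← h3, ← h2, ← lintegral_indicator measurableSet_Ioo]
    refine lintegral_congr fun y => ?_
    have : (X, y) ∈ diskSegment c κ ↔ y ∈ Ioo (-R) R := by
      simp only [diskSegment, mem_ofPred_eq]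
      have hk : κ < c * X := by
        have := hX.1; rwa [div_lt_iff₀ hc, mul_comm] at this
      rw [mem_Ioo, ← abs_lt, ← sq_lt_sq₀ (abs_nonneg _) (sqrt_nonneg _), sq_abs]
      constructor
      · rintro ⟨h, -⟩
        have : c ^ 2 * y ^ 2 < c ^ 2 * R ^ 2 := by linarith
        exact lt_of_mul_lt_mul_left this (by positivity)
      · intro h
        have : c ^ 2 * y ^ 2 < c ^ 2 * R ^ 2 := mul_lt_mul_of_pos_left h (by positivity)
        exact ⟨by linarith, hk⟩
    simp only [indicator, this]
  · rw [indicator_of_notMem hX]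
    have : ∀ y, (X, y) ∉ diskSegment c κ := by
      rintro y ⟨h1, h2⟩
      simp only at h1 h2
      refine hX ⟨by rw [div_lt_iff₀ hc]; linarith, ?_⟩
      rw [lt_div_iff₀ hc]
      refine lt_of_pow_lt_pow_left₀ 2 hs.le ?_
      nlinarith [mul_nonneg (sq_nonneg c) (sq_nonneg y)]
    simp [this]

theorem div_mul_sqrt_eq_gnomonic {c s κ : ℝ} (hc : 0 < c) :
    κ / (s * √(c ^ 2 + κ ^ 2)) = κ / c / (s * √(1 + (κ / c) ^ 2)) := by
  have h1 : √(c ^ 2 + κ ^ 2) = c * √(1 + (κ / c) ^ 2) := by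
    rw [← sqrt_sq hc.le, ← sqrt_mul (sq_nonneg c), sqrt_sq hc.le]
    congr 1; field_simp
  rw [h1]; field_simp

/-- The area of a digon cut out of a cap by a great circle. -/
theorem sphereArea_openDigon (b : OrthonormalBasis (Fin 3) ℝ E3) {c s κ : ℝ} (hc : 0 < c)
    (hs : 0 < s) (hcs : c ^ 2 + s ^ 2 = 1) (hκ : κ ∈ Ioo (-s) s) :
    sphereArea (openDigon b c κ) = ENNReal.ofReal
      (2 * arccos (κ / (s * √(c ^ 2 + κ ^ 2))) - 2 * c * arccos (κ / s)) := by
  rw [sphereArea_openDigon_eq_volume b κ hc, volume_coneRegion,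
    lintegral_diskSegment hc hs hcs hκ, lintegral_gnomonic_area hc hs hcs]
  · have h2 : κ / c / (s / c) = κ / s := by field_simp
    rw [div_mul_sqrt_eq_gnomonic hc, h2, show (3 : ENNReal) = ENNReal.ofReal 3 by simp,
      ← ENNReal.ofReal_mul (by norm_num)]
    congr 1; ring
  · rw [← neg_div]
    exact ⟨div_lt_div_of_pos_right hκ.1 hc, div_lt_div_of_pos_right hκ.2 hc⟩

end Cone

/-! ### Angular measure of an intersection of half-planes. -/

section Angle

theorem setOf_cos_pos_inter_of_nonneg {d : ℝ} (h0 : 0 ≤ d) (hd : d ≤ π) :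
    {θ : ℝ | θ ∈ Ioc (-π) π ∧ 0 < cos θ ∧ 0 < cos (θ - d)} = Ioo (d - π / 2) (π / 2) := by
  ext θ
  simp only [mem_ofPred_eq, mem_Ioc, mem_Ioo]
  constructor
  · rintro ⟨⟨h1, h2⟩, h3, h4⟩
    have h5 : θ < π / 2 := by
      by_contra! h
      exact absurd h3 (not_lt.2 (cos_nonpos_of_pi_div_two_le_of_le h (by linarith)))
    have h6 : -(π / 2) < θ := by
      by_contra! h
      have := cos_nonpos_of_pi_div_two_le_of_le (x := -θ) (by linarith) (by linarith)
      rw [cos_neg] at this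
      exact absurd h3 (not_lt.2 this)
    refine ⟨?_, h5⟩
    by_contra! h
    have := cos_nonpos_of_pi_div_two_le_of_le (x := -(θ - d)) (by linarith) (by linarith)
    rw [cos_neg] at this
    exact absurd h4 (not_lt.2 this)
  · rintro ⟨h1, h2⟩
    have := pi_pos
    exact ⟨⟨by linarith, by linarith⟩, cos_pos_of_mem_Ioo ⟨by linarith, h2⟩,
      cos_pos_of_mem_Ioo ⟨by linarith, by linarith⟩⟩

theorem volume_cos_pos_inter {d : ℝ} (hd : |d| ≤ π) :
    volume {θ : ℝ | θ ∈ Ioc (-π) π ∧ 0 < cos θ ∧ 0 < cos (θ - d)} =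
      ENNReal.ofReal (π - |d|) := by
  rcases le_total 0 d with h | h
  · rw [abs_of_nonneg h] at hd ⊢
    rw [setOf_cos_pos_inter_of_nonneg h hd, Real.volume_Ioo]
    congr 1; ring
  · rw [abs_of_nonpos h] at hd ⊢
    have h1 : Ioo (-d - π / 2) (π / 2) = (fun θ => -θ) ⁻¹' Ioo (-(π / 2)) (d + π / 2) := by
      ext θ; simp only [mem_Ioo, mem_preimage]; constructor <;> rintro ⟨h1, h2⟩ <;>
        constructor <;> linarith
    have h2 : {θ : ℝ | θ ∈ Ioc (-π) π ∧ 0 < cos θ ∧ 0 < cos (θ - d)} = Ioo (-(π / 2)) (d + π / 2) := by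
      have h3 := setOf_cos_pos_inter_of_nonneg (d := -d) (by linarith) hd
      ext θ
      have h4 := Set.ext_iff.1 h3 (-θ)
      simp only [mem_ofPred_eq, mem_Ioc, mem_Ioo, cos_neg,
        show -θ - -d = -(θ - d) by ring] at h4 ⊢
      constructor
      · rintro ⟨⟨h5, h6⟩, h7, h8⟩
        have hne : θ ≠ π := by rintro rfl; rw [cos_pi] at h7; norm_num at h7
        have := h4.1 ⟨⟨by linarith [lt_of_le_of_ne h6 hne], by linarith⟩, h7, h8⟩
        constructor <;> linarith [this.1, this.2]
      · rintro ⟨h5, h6⟩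
        have := h4.2 ⟨by linarith, by linarith⟩
        exact ⟨⟨by linarith [pi_pos], by linarith [this.1.1]⟩, this.2⟩
    rw [h2, Real.volume_Ioo]
    congr 1; ring

/-- Every half-open interval of length `2π` is a fundamental domain for translation by `2π`; thus a
set of directions may be rotated before it is measured. -/
theorem volume_periodic_inter_Ioc {A : Set ℝ} (hA : MeasurableSet A)
    (hper : ∀ θ, θ + 2 * π ∈ A ↔ θ ∈ A) (t : ℝ) :
    volume (A ∩ Ioc t (t + 2 * π)) = volume (A ∩ Ioc (-π) π) := by
  have h1 := (isAddFundamentalDomain_Ioc two_pi_pos t volume).measure_set_eq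
    (isAddFundamentalDomain_Ioc two_pi_pos (-π) volume) hA (by
      rintro ⟨g, hg⟩
      obtain ⟨n, rfl⟩ := AddSubgroup.mem_zmultiples_iff.1 hg
      have hP : Function.Periodic (fun θ => θ ∈ A) (2 * π) := fun θ => propext (hper θ)
      ext θ
      have := hP.zsmul n θ
      simp only [mem_preimage, AddSubgroup.mk_vadd, vadd_eq_add]
      rw [add_comm]
      exact this.to_iff)
  rw [h1]; congr 3; ring

theorem volume_cos_sub_pos_inter (a : ℝ) {d : ℝ} (hd : |d| ≤ π) :
    volume {θ : ℝ | θ ∈ Ioc (-π) π ∧ 0 < cos (θ - a) ∧ 0 < cos (θ - (a + d))} =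
      ENNReal.ofReal (π - |d|) := by
  let A : Set ℝ := {θ | 0 < cos (θ - a)} ∩ {θ | 0 < cos (θ - (a + d))}
  have hA : MeasurableSet A :=
    (measurableSet_lt (by fun_prop) (by fun_prop)).inter
      (measurableSet_lt (by fun_prop) (by fun_prop))
  have hper : ∀ θ, θ + 2 * π ∈ A ↔ θ ∈ A := by
    intro θ
    simp only [A, mem_inter_iff, mem_ofPred_eq, add_sub_right_comm θ, cos_add_two_pi]
  have h1 : {θ : ℝ | θ ∈ Ioc (-π) π ∧ 0 < cos (θ - a) ∧ 0 < cos (θ - (a + d))} =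
      A ∩ Ioc (-π) π := by
    ext θ; simp only [A, mem_inter_iff, mem_ofPred_eq]; tauto
  rw [h1, ← volume_periodic_inter_Ioc hA hper (a - π), ← volume_cos_pos_inter hd,
    ← measure_preimage_add_right volume a (A ∩ _)]
  congr 1
  ext θ
  simp only [A, mem_inter_iff, mem_preimage, mem_ofPred_eq, mem_Ioc, add_sub_cancel_right,
    show θ + a - (a + d) = θ - d by ring]
  constructor
  · rintro ⟨⟨h1, h2⟩, h3, h4⟩
    exact ⟨⟨by linarith, by linarith⟩, h1, h2⟩
  · rintro ⟨⟨h3, h4⟩, h1, h2⟩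
    exact ⟨⟨h1, h2⟩, by linarith, by linarith⟩

/-- The directions in the intersection of two open half-planes. -/
theorem volume_halfPlane_inter {A B A' B' : ℝ} (h : 0 < A ^ 2 + B ^ 2) (h' : 0 < A' ^ 2 + B' ^ 2) :
    volume {θ : ℝ | θ ∈ Ioc (-π) π ∧ 0 < A * cos θ + B * sin θ ∧ 0 < A' * cos θ + B' * sin θ} =
      ENNReal.ofReal (arccos (-(A * A' + B * B') /
        (√(A ^ 2 + B ^ 2) * √(A' ^ 2 + B' ^ 2)))) := by
  obtain ⟨a, -, e1, e2⟩ := exists_polar A B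
  have hρ := sqrt_pos.2 h
  have hρ' := sqrt_pos.2 h'
  set ρ := √(A ^ 2 + B ^ 2)
  set ρ' := √(A' ^ 2 + B' ^ 2) with hρ'def
  -- Rotating the second normal by `-a` makes its polar angle `d` the signed angle from the first
  -- normal to the second, already reduced to `(-π, π]`.
  obtain ⟨d, hd, e3, e4⟩ := exists_polar (A' * cos a + B' * sin a) (B' * cos a - A' * sin a)
  have e5 : (A' * cos a + B' * sin a) ^ 2 + (B' * cos a - A' * sin a) ^ 2 = A' ^ 2 + B' ^ 2 := by
    linear_combination (A' ^ 2 + B' ^ 2) * sin_sq_add_cos_sq a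
  rw [e5, ← hρ'def] at e3 e4
  have e6 : A' = ρ' * cos (a + d) := by
    rw [cos_add]
    linear_combination cos a * e3 - sin a * e4 - A' * sin_sq_add_cos_sq a
  have e7 : B' = ρ' * sin (a + d) := by
    rw [sin_add]
    linear_combination sin a * e3 + cos a * e4 - B' * sin_sq_add_cos_sq a
  have hdπ : |d| ≤ π := abs_le.2 ⟨hd.1.le, hd.2⟩
  have hset : ∀ θ, (0 < A * cos θ + B * sin θ ∧ 0 < A' * cos θ + B' * sin θ) ↔
      (0 < cos (θ - a) ∧ 0 < cos (θ - (a + d))) := by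
    intro θ
    have f1 : A * cos θ + B * sin θ = ρ * cos (θ - a) := by
      rw [cos_sub]; linear_combination cos θ * e1 + sin θ * e2
    have f2 : A' * cos θ + B' * sin θ = ρ' * cos (θ - (a + d)) := by
      rw [cos_sub θ]; linear_combination cos θ * e6 + sin θ * e7
    rw [f1, f2, mul_pos_iff_of_pos_left hρ, mul_pos_iff_of_pos_left hρ']
  simp only [hset]
  rw [volume_cos_sub_pos_inter a hdπ]
  have hin : A * A' + B * B' = ρ * ρ' * cos d := by
    linear_combination ρ * e3 + A' * e1 + B' * e2
  rw [hin, neg_div, mul_div_cancel_left₀ _ (by positivity), arccos_neg, ← cos_abs,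
    arccos_cos (abs_nonneg _) hdπ]

end Angle

theorem exists_orthonormalBasis_eq {v : Fin 3 → E3} (hv : Orthonormal ℝ v) :
    ∃ e : OrthonormalBasis (Fin 3) ℝ E3, ⇑e = v := by
  have hspan : Submodule.span ℝ (range v) = ⊤ :=
    hv.linearIndependent.span_eq_top_of_card_eq_finrank' (by simp)
  exact ⟨OrthonormalBasis.mk hv hspan.ge, OrthonormalBasis.coe_mk _ _⟩

/-! ### The interior angle at a vertex. -/

section InteriorAngle

variable (b : OrthonormalBasis (Fin 3) ℝ E3) {c s κ : ℝ}

/-- At a vertex both defining inequalities are equalities. The plane condition is linear, so only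
the sign of its value at `τ` matters. The cap condition is `c(1 - cos σ) < sin σ ⟪b 0, τ⟫`; its left
side is nonnegative, which excludes directions tangent to the circle. -/
theorem eventually_mem_openDigon_iff (hc : 0 < c) {v τ : E3} (hv : ‖v‖ = 1) (hτ : ‖τ‖ = 1)
    (hvτ : inner ℝ v τ = 0) (hv0 : inner ℝ (b 0) v = c)
    (hv1 : κ * inner ℝ (b 0) v = c * inner ℝ (b 1) v) :
    (∀ᶠ σ in 𝓝[>] (0 : ℝ), cos σ • v + sin σ • τ ∈ openDigon b c κ) ↔
      0 < inner ℝ (b 0) τ ∧ 0 < c * inner ℝ (b 1) τ - κ * inner ℝ (b 0) τ := by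
  have hnorm : ∀ σ, ‖cos σ • v + sin σ • τ‖ = 1 := norm_greatCircle hv hτ hvτ
  have hmem : ∀ σ ∈ Ioo (0 : ℝ) (π / 2), (cos σ • v + sin σ • τ ∈ openDigon b c κ ↔
      c * (1 - cos σ) < sin σ * inner ℝ (b 0) τ ∧
        0 < c * inner ℝ (b 1) τ - κ * inner ℝ (b 0) τ) := by
    intro σ hσ
    have hsin : 0 < sin σ := sin_pos_of_pos_of_lt_pi hσ.1 (by linarith [hσ.2, pi_pos])
    simp only [openDigon, mem_ofPred_eq, hnorm, true_and, inner_add_right, real_inner_smul_right]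
    rw [← mul_pos_iff_of_pos_left (b := c * inner ℝ (b 1) τ - κ * inner ℝ (b 0) τ) hsin]
    refine and_congr ?_ ?_
    · rw [hv0]; constructor <;> intro h <;> linarith
    · have : cos σ * (κ * inner ℝ (b 0) v) = cos σ * (c * inner ℝ (b 1) v) := by rw [hv1]
      constructor <;> intro h <;> linarith
  have hIoo : Ioo (0 : ℝ) (π / 2) ∈ 𝓝[>] (0 : ℝ) := Ioo_mem_nhdsGT (by linarith [pi_pos])
  constructor
  · intro h
    obtain ⟨σ, h1, h2⟩ := (h.and hIoo).exists
    obtain ⟨h3, h4⟩ := (hmem σ h2).1 h1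
    have hsin : 0 < sin σ := sin_pos_of_pos_of_lt_pi h2.1 (by linarith [h2.2, pi_pos])
    refine ⟨?_, h4⟩
    have : 0 ≤ c * (1 - cos σ) := mul_nonneg hc.le (by linarith [cos_le_one σ])
    exact (mul_pos_iff_of_pos_left hsin).1 (by linarith)
  · rintro ⟨h1, h2⟩
    have hlim : Tendsto (fun σ : ℝ => cos (σ / 2) * inner ℝ (b 0) τ - c * sin (σ / 2)) (𝓝[>] 0)
        (𝓝 (cos (0 / 2) * inner ℝ (b 0) τ - c * sin (0 / 2))) :=
      (Continuous.tendsto (by fun_prop) 0).mono_left nhdsWithin_le_nhds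
    have hpos : 0 < cos (0 / 2) * inner ℝ (b 0) τ - c * sin (0 / 2) := by simpa using h1
    filter_upwards [hlim.eventually (lt_mem_nhds hpos), hIoo] with σ h3 hσ
    refine (hmem σ hσ).2 ⟨?_, h2⟩
    have hs2 : 0 < sin (σ / 2) :=
      sin_pos_of_pos_of_lt_pi (by linarith [hσ.1]) (by linarith [hσ.2, pi_pos])
    have e1 : cos σ = 1 - 2 * sin (σ / 2) ^ 2 := by
      have := Real.cos_two_mul (σ / 2)
      rw [mul_div_cancel₀ _ two_ne_zero] at this
      linarith [sin_sq_add_cos_sq (σ / 2)]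
    have e2 : sin σ = 2 * sin (σ / 2) * cos (σ / 2) := by
      rw [← Real.sin_two_mul, mul_div_cancel₀ _ two_ne_zero]
    rw [e1, e2]
    nlinarith [mul_pos hs2 h3]

/-- The interior angle of a digon at a vertex. -/
theorem hasInteriorAngle_openDigon (hc : 0 < c) (hs : 0 < s) (hcs : c ^ 2 + s ^ 2 = 1) {v : E3}
    (hv0 : inner ℝ (b 0) v = c) (hv1 : κ * inner ℝ (b 0) v = c * inner ℝ (b 1) v) :
    HasInteriorAngle (openDigon b c κ) v (arccos (κ / (s * √(c ^ 2 + κ ^ 2)))) := by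
  refine ⟨arccos_nonneg _, fun u w hon => ?_⟩
  obtain ⟨e, he⟩ := exists_orthonormalBasis_eq hon
  have he0 : e 0 = v := by rw [he]; rfl
  have he1 : e 1 = u := by rw [he]; rfl
  have he2 : e 2 = w := by rw [he]; rfl
  have parseval : ∀ x y : E3, inner ℝ x v * inner ℝ y v + inner ℝ x u * inner ℝ y u +
      inner ℝ x w * inner ℝ y w = inner ℝ x y := by
    intro x y
    have := e.sum_inner_mul_inner x y
    rw [Fin.sum_univ_three, he0, he1, he2] at this
    rw [← this, real_inner_comm y v, real_inner_comm y u, real_inner_comm y w]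
  have ortho := fun i j => inner_basis_eq e i j
  have nv : ‖v‖ = 1 := he0 ▸ e.norm_eq_one 0
  have nu : ‖u‖ = 1 := he1 ▸ e.norm_eq_one 1
  have nw : ‖w‖ = 1 := he2 ▸ e.norm_eq_one 2
  have huw : inner ℝ u w = 0 := by have := ortho 1 2; rwa [he1, he2] at this
  have hvu : inner ℝ v u = 0 := by have := ortho 0 1; rwa [he0, he1] at this
  have hvw : inner ℝ v w = 0 := by have := ortho 0 2; rwa [he0, he2] at this
  have p00 := parseval (b 0) (b 0)
  have p01 := parseval (b 0) (b 1)
  have p11 := parseval (b 1) (b 1)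
  rw [inner_basis_eq b] at p00 p01 p11
  simp only [if_true, Fin.isValue, zero_ne_one, if_false] at p00 p01 p11
  set A := inner ℝ (b 0) u
  set B := inner ℝ (b 0) w
  set A₁ := inner ℝ (b 1) u
  set B₁ := inner ℝ (b 1) w
  set v₁ := inner ℝ (b 1) v
  rw [hv0] at p00 p01 hv1
  have hv1' : v₁ = κ := mul_left_cancel₀ hc.ne' (by linarith)
  rw [hv1'] at p01 p11
  -- Gram data of the two normals in the tangent plane: the projection of `b 0` has length `s`, the
  -- vector `c • b 1 - κ • b 0` is already tangent at `v` with length `√(c² + κ²)`, and their inner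
  -- product is `-κ`.
  have q1 : A ^ 2 + B ^ 2 = s ^ 2 := by linarith
  have q2 : (c * A₁ - κ * A) ^ 2 + (c * B₁ - κ * B) ^ 2 = c ^ 2 + κ ^ 2 := by
    linear_combination c ^ 2 * p11 - 2 * c * κ * p01 + κ ^ 2 * p00
  have q3 : -(A * (c * A₁ - κ * A) + B * (c * B₁ - κ * B)) = κ := by
    linear_combination κ * p00 - c * p01
  have hset : ∀ θ : ℝ,
      (∀ᶠ σ in 𝓝[>] (0 : ℝ), cos σ • v + sin σ • (cos θ • u + sin θ • w) ∈ openDigon b c κ) ↔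
      (0 < A * cos θ + B * sin θ ∧
        0 < (c * A₁ - κ * A) * cos θ + (c * B₁ - κ * B) * sin θ) := by
    intro θ
    have hτ : ‖cos θ • u + sin θ • w‖ = 1 := norm_greatCircle nu nw huw θ
    rw [eventually_mem_openDigon_iff b hc nv hτ
      (by rw [inner_add_right, real_inner_smul_right, real_inner_smul_right, hvu, hvw]; simp) hv0
      (by rw [hv0]; exact hv1)]
    simp only [inner_add_right, real_inner_smul_right]
    refine and_congr ?_ ?_ <;> refine iff_of_eq (congrArg _ ?_) <;> ring
  simp only [hset]
  rw [volume_halfPlane_inter (by rw [q1]; positivity) (by rw [q2]; positivity), q1, q2, q3,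
    sqrt_sq hs.le]

end InteriorAngle

/-! ### The frame adapted to the arc and its chord. -/

section Frame

/-- In a suitable frame the projected geodesic is a small circle. -/
theorem exists_frame {β : ℝ} (hβ : β ≠ 0) (h : ℝ) :
    ∃ b : OrthonormalBasis (Fin 3) ℝ E3, ∀ t, projGeo β t =
      smallCircle b (|β| / √(1 + β ^ 2)) (1 / √(1 + β ^ 2)) (t * √(1 + β ^ 2) - h) := by
  have hpos : 0 < 1 + β ^ 2 := by positivity
  have hω : 0 < √(1 + β ^ 2) := sqrt_pos.2 hpos
  have hω2 : √(1 + β ^ 2) ^ 2 = 1 + β ^ 2 := sq_sqrt hpos.le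
  -- `σ` is a sign matching `β`. It orients the rotation axis `(β, 0, 1)/ω` towards `x(0)`, so that
  -- `c` is positive for either sign of `β`.
  obtain ⟨σ, hσ, hσβ⟩ : ∃ σ : ℝ, σ ^ 2 = 1 ∧ σ * |β| = β := by
    rcases le_total 0 β with hb | hb
    · exact ⟨1, by norm_num, by rw [abs_of_nonneg hb, one_mul]⟩
    · exact ⟨-1, by norm_num, by rw [abs_of_nonpos hb]; ring⟩
  set ω := √(1 + β ^ 2) with hωdef
  set c := |β| / ω with hc
  set s := 1 / ω with hs
  have hcs : c ^ 2 + s ^ 2 = 1 := by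
    rw [hc, hs, div_pow, div_pow, sq_abs, hω2]; field_simp; ring
  have hσc : σ * c = β * s := by rw [hc, hs, ← mul_div_assoc, hσβ]; ring
  have hsc := sin_sq_add_cos_sq h
  have hon : Orthonormal ℝ (![!₂[c, 0, σ * s], !₂[s * cos h, sin h, -(σ * c * cos h)],
      !₂[-(s * sin h), cos h, σ * c * sin h]] : Fin 3 → E3) := by
    have hin : ∀ x y : E3, inner ℝ x y = x 0 * y 0 + x 1 * y 1 + x 2 * y 2 := by
      intro x y
      simp [PiLp.inner_apply, Fin.sum_univ_three, mul_comm]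
    rw [orthonormal_iff_ite]
    intro i j
    rw [hin]
    fin_cases i <;> fin_cases j <;> simp
    · linear_combination hcs + s ^ 2 * hσ
    · linear_combination (-s * c * cos h) * hσ
    · linear_combination (s * c * sin h) * hσ
    · linear_combination (-s * c * cos h) * hσ
    · linear_combination cos h ^ 2 * hcs + hsc + c ^ 2 * cos h ^ 2 * hσ
    · linear_combination - sin h * cos h * hcs - c ^ 2 * sin h * cos h * hσ
    · linear_combination (s * c * sin h) * hσ
    · linear_combination - sin h * cos h * hcs - c ^ 2 * sin h * cos h * hσ
    · linear_combination sin h ^ 2 * hcs + hsc + c ^ 2 * sin h ^ 2 * hσ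
  obtain ⟨b, hb⟩ := exists_orthonormalBasis_eq hon
  refine ⟨b, fun t => ?_⟩
  have hn : nFun β t = s ^ 2 * (1 - cos (t * ω)) := by
    rw [nFun, ← hωdef, ← hω2, hs]; field_simp
  have hm : mFun β t = s * sin (t * ω) := by
    rw [mFun, ← hωdef, hs]; field_simp
  rw [projGeo_eq, smallCircle_eq, hb, hn, hm, cos_sub, sin_sub]
  ext i
  fin_cases i <;> simp
  · linear_combination (-1) * hcs - s ^ 2 * cos (t * ω) * hsc
  · linear_combination (-s * sin (t * ω)) * hsc
  · linear_combination (-s * (1 - cos (t * ω))) * hσc + σ * c * s * cos (t * ω) * hsc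

variable (b : OrthonormalBasis (Fin 3) ℝ E3) {c s h : ℝ}

/-- The chord between two points of a small circle, as the arc of a great circle. -/
theorem exists_greatCircle_eq (hc : 0 < c) (hs : 0 < s) (hcs : c ^ 2 + s ^ 2 = 1) (h0 : 0 ≤ h)
    (hπ : h < π) :
    ∃ (k w : E3) (d : ℝ), ‖k‖ = 1 ∧ ‖w‖ = 1 ∧ inner ℝ k w = 0 ∧ 0 ≤ d ∧ d < π / 2 ∧
      cos d ^ 2 = 1 - s ^ 2 * sin h ^ 2 ∧
      greatCircle k w (-d) = smallCircle b c s (-h) ∧ greatCircle k w d = smallCircle b c s h ∧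
      greatCircle k w '' Icc (-d) d = capChord b c (s * cos h) := by
  set κ := s * cos h with hκ
  have hLpos : 0 < c ^ 2 + κ ^ 2 := by positivity
  -- The vertices are `c • b 0 + κ • b 1 ± (s sin h) • b 2`. Hence the midpoint of the chord has
  -- direction `c • b 0 + κ • b 1`, of norm `L`, and the half-length `d` has `cos d = L`, `sin d = s
  -- sin h`.
  set L := √(c ^ 2 + κ ^ 2) with hL
  have hL0 : 0 < L := sqrt_pos.2 hLpos
  have hL2 : L ^ 2 = c ^ 2 + κ ^ 2 := sq_sqrt hLpos.le
  have hL2' : L ^ 2 = 1 - s ^ 2 * sin h ^ 2 := by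
    rw [hL2, hκ]; linear_combination hcs + s ^ 2 * sin_sq_add_cos_sq h
  have hL1 : L ≤ 1 := by nlinarith [mul_nonneg (sq_nonneg s) (sq_nonneg (sin h))]
  have hsin0 : 0 ≤ sin h := sin_nonneg_of_nonneg_of_le_pi h0 hπ.le
  have hcosd : cos (arccos L) = L := cos_arccos (by linarith) hL1
  have hsind : sin (arccos L) = s * sin h := by
    rw [sin_arccos, show 1 - L ^ 2 = (s * sin h) ^ 2 by rw [hL2']; ring,
      sqrt_sq (by positivity)]
  set k : E3 := (c / L) • b 0 + (κ / L) • b 1 + (0 : ℝ) • b 2 with hk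
  have hgc : ∀ σ, greatCircle k (b 2) σ =
      (cos σ * (c / L)) • b 0 + (cos σ * (κ / L)) • b 1 + sin σ • b 2 := by
    intro σ; simp only [greatCircle, hk]; module
  have hk1 : ‖k‖ = 1 := by
    have : ‖k‖ ^ 2 = 1 := by
      rw [hk, norm_sq_coord, div_pow, div_pow, hL2]; field_simp; ring
    nlinarith [norm_nonneg k]
  have hkw : inner ℝ k (b 2) = 0 := by rw [real_inner_comm, hk, inner_coord_two]
  refine ⟨k, b 2, arccos L, hk1, b.norm_eq_one 2, hkw, arccos_nonneg _,
    arccos_lt_pi_div_two.2 hL0, by rw [hcosd, hL2'], ?_, ?_, ?_⟩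
  · rw [hgc, smallCircle_eq, cos_neg, sin_neg, hcosd, hsind, mul_div_cancel₀ _ hL0.ne',
      mul_div_cancel₀ _ hL0.ne', cos_neg, sin_neg, mul_neg]
  · rw [hgc, smallCircle_eq, hcosd, hsind, mul_div_cancel₀ _ hL0.ne', mul_div_cancel₀ _ hL0.ne']
  · ext y
    constructor
    · rintro ⟨σ, hσ, rfl⟩
      refine ⟨norm_greatCircle hk1 (b.norm_eq_one 2) hkw σ, ?_, ?_⟩
      · rw [hgc, inner_coord_zero]
        have : cos (arccos L) ≤ cos |σ| :=
          cos_le_cos_of_nonneg_of_le_pi (abs_nonneg _) (arccos_le_pi _) (abs_le.2 hσ)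
        rw [hcosd, cos_abs] at this
        rw [← mul_div_assoc, le_div_iff₀ hL0]
        nlinarith
      · rw [hgc, inner_coord_zero, inner_coord_one]; ring
    · rintro ⟨h1, h2, h3⟩
      have hn := norm_sq_eq_coord b y
      have hy := eq_coord b y
      generalize inner ℝ (b 0) y = z at *
      generalize inner ℝ (b 1) y = x at *
      generalize inner ℝ (b 2) y = Y at *
      have hX : 0 < z * L / c := by have : 0 < z := hc.trans_le h2; positivity
      have hxz : x = κ * z / c := by rw [h3]; field_simp
      have hsq : (z * L / c) ^ 2 + Y ^ 2 = 1 := by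
        have : z ^ 2 + x ^ 2 + Y ^ 2 = 1 := by rw [← hn, h1]; norm_num
        rw [← this, hxz, div_pow, mul_pow, hL2]; field_simp
      have hY1 : Y ^ 2 ≤ 1 := by linarith [sq_nonneg (z * L / c)]
      have hY' := abs_le.1 ((sq_le_one_iff_abs_le_one Y).1 hY1)
      have hsinY : sin (arcsin Y) = Y := sin_arcsin hY'.1 hY'.2
      have hcosY : cos (arcsin Y) = z * L / c := by
        rw [cos_arcsin, show 1 - Y ^ 2 = (z * L / c) ^ 2 by linarith, sqrt_sq hX.le]
      refine ⟨arcsin Y, ?_, ?_⟩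
      · rw [mem_Icc, ← abs_le]
        by_contra! hlt
        have hle : |arcsin Y| ≤ π := abs_le.2
          ⟨by linarith [neg_pi_div_two_le_arcsin Y, pi_pos],
            by linarith [arcsin_le_pi_div_two Y, pi_pos]⟩
        have := cos_lt_cos_of_nonneg_of_le_pi (arccos_nonneg _) hle hlt
        rw [hcosd, cos_abs, hcosY, div_lt_iff₀ hc, mul_comm L] at this
        exact absurd (lt_of_mul_lt_mul_right this hL0.le) (not_lt.2 h2)
      · rw [hgc, hsinY, hcosY]
        have e1 : z * L / c * (c / L) = z := by field_simp
        have e2 : z * L / c * (κ / L) = x := by rw [hxz]; field_simp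
        rw [e1, e2, ← hy]

end Frame

/-! ### Formulas for length, angle and area as functions of time. -/

/-- The cosine of the spherical radius of the circle traced by the projected geodesic. -/
noncomputable def capCos (β : ℝ) : ℝ := |β| / √(1 + β ^ 2)

/-- The sine of the spherical radius of the circle traced by the projected geodesic. -/
noncomputable def capSin (β : ℝ) : ℝ := 1 / √(1 + β ^ 2)

/-- The offset of the plane of the chord from `x(0)` to `x(t)`. -/
noncomputable def chordOffset (β t : ℝ) : ℝ := capSin β * cos (t * √(1 + β ^ 2) / 2)

/-- The interior angle of the digon cut off by the chord from `x(0)` to `x(t)`. -/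
noncomputable def digonAngle (β t : ℝ) : ℝ :=
  arccos (mFun β t / √(nFun β t * (2 - nFun β t)))

theorem sqrt_one_add_sq_pos (β : ℝ) : 0 < √(1 + β ^ 2) := sqrt_pos.2 (by positivity)

theorem capSin_pos (β : ℝ) : 0 < capSin β := div_pos one_pos (sqrt_one_add_sq_pos β)

theorem capCos_pos {β : ℝ} (hβ : β ≠ 0) : 0 < capCos β :=
  div_pos (abs_pos.2 hβ) (sqrt_one_add_sq_pos β)

theorem capCos_sq_add_capSin_sq (β : ℝ) : capCos β ^ 2 + capSin β ^ 2 = 1 := by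
  have : √(1 + β ^ 2) ^ 2 = 1 + β ^ 2 := sq_sqrt (by positivity)
  rw [capCos, capSin, div_pow, div_pow, sq_abs, this]
  have : 1 + β ^ 2 ≠ 0 := by positivity
  field_simp; ring

theorem capCos_mul_sqrt (β : ℝ) : capCos β * √(1 + β ^ 2) = |β| :=
  div_mul_cancel₀ _ (sqrt_one_add_sq_pos β).ne'

theorem half_angle_lt_pi_iff (β t : ℝ) : t * √(1 + β ^ 2) / 2 < π ↔ t < 2 * π / √(1 + β ^ 2) := by
  rw [lt_div_iff₀ (sqrt_one_add_sq_pos β), div_lt_iff₀ two_pos, mul_comm π]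

theorem sin_half_angle_pos {β t : ℝ} (h0 : 0 < t) (h1 : t < 2 * π / √(1 + β ^ 2)) :
    0 < sin (t * √(1 + β ^ 2) / 2) :=
  sin_pos_of_pos_of_lt_pi (by have := sqrt_one_add_sq_pos β; positivity)
    ((half_angle_lt_pi_iff β t).2 h1)

theorem nFun_eq (β t : ℝ) : nFun β t = 2 * capSin β ^ 2 * sin (t * √(1 + β ^ 2) / 2) ^ 2 := by
  have h : √(1 + β ^ 2) ^ 2 = 1 + β ^ 2 := sq_sqrt (by positivity)
  have e : cos (t * √(1 + β ^ 2)) = 1 - 2 * sin (t * √(1 + β ^ 2) / 2) ^ 2 := by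
    have := Real.cos_two_mul (t * √(1 + β ^ 2) / 2)
    rw [mul_div_cancel₀ _ two_ne_zero] at this
    linarith [sin_sq_add_cos_sq (t * √(1 + β ^ 2) / 2)]
  rw [nFun, capSin, div_pow, h, e]; ring

theorem mFun_eq (β t : ℝ) : mFun β t =
    2 * capSin β * sin (t * √(1 + β ^ 2) / 2) * cos (t * √(1 + β ^ 2) / 2) := by
  have e : sin (t * √(1 + β ^ 2)) =
      2 * sin (t * √(1 + β ^ 2) / 2) * cos (t * √(1 + β ^ 2) / 2) := by
    rw [← Real.sin_two_mul, mul_div_cancel₀ _ two_ne_zero]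
  rw [mFun, capSin, e]; ring

theorem capCos_sq_add_chordOffset_sq (β t : ℝ) : capCos β ^ 2 + chordOffset β t ^ 2 =
    1 - capSin β ^ 2 * sin (t * √(1 + β ^ 2) / 2) ^ 2 := by
  rw [chordOffset]
  linear_combination capCos_sq_add_capSin_sq β +
    capSin β ^ 2 * sin_sq_add_cos_sq (t * √(1 + β ^ 2) / 2)

theorem capCos_sq_add_chordOffset_sq_lt_one {β t : ℝ} (h0 : 0 < t)
    (h1 : t < 2 * π / √(1 + β ^ 2)) : capCos β ^ 2 + chordOffset β t ^ 2 < 1 := by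
  have hsin := sin_half_angle_pos h0 h1
  have hs := capSin_pos β
  rw [capCos_sq_add_chordOffset_sq]
  have : 0 < capSin β ^ 2 * sin (t * √(1 + β ^ 2) / 2) ^ 2 := by positivity
  linarith

section

variable {β t : ℝ} (hβ : β ≠ 0) (h0 : 0 < t) (h1 : t < 2 * π / √(1 + β ^ 2))
include hβ h0 h1

theorem chordOffset_mem_Ioo : chordOffset β t ∈ Ioo (-capSin β) (capSin β) :=
  mul_cos_mem_Ioo (capSin_pos β) (by have := sqrt_one_add_sq_pos β; positivity)
    ((half_angle_lt_pi_iff β t).2 h1)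

/-- In the half angle `h`, with `L² = c² + κ²`, one has `m = 2s sin h cos h` and `n(2 - n) = (2s sin
h · L)²`; the root is extracted using `sin h > 0`. This identifies the geometric cosine of the angle
with the stated one. -/
theorem mFun_div_sqrt_eq : mFun β t / √(nFun β t * (2 - nFun β t)) =
    chordOffset β t / (capSin β * √(capCos β ^ 2 + chordOffset β t ^ 2)) := by
  have hsin := sin_half_angle_pos h0 h1
  have hs := capSin_pos β
  have hc := capCos_pos hβ
  have hL : 0 < capCos β ^ 2 + chordOffset β t ^ 2 := by positivity
  have hL0 := sqrt_pos.2 hL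
  have e : nFun β t * (2 - nFun β t) = (2 * capSin β * sin (t * √(1 + β ^ 2) / 2) *
      √(capCos β ^ 2 + chordOffset β t ^ 2)) ^ 2 := by
    rw [mul_pow, sq_sqrt hL.le, capCos_sq_add_chordOffset_sq, nFun_eq]; ring
  rw [e, sqrt_sq (by positivity), mFun_eq]
  generalize √(capCos β ^ 2 + chordOffset β t ^ 2) = L at *
  rw [chordOffset]
  field_simp

theorem digonAngle_eq : digonAngle β t =
    arccos (chordOffset β t / (capSin β * √(capCos β ^ 2 + chordOffset β t ^ 2))) := by
  rw [digonAngle, mFun_div_sqrt_eq hβ h0 h1]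

theorem mFun_div_sqrt_mem_Ioo : mFun β t / √(nFun β t * (2 - nFun β t)) ∈ Ioo (-1) 1 := by
  have hs := capSin_pos β
  have hc := capCos_pos hβ
  have hL : 0 < capCos β ^ 2 + chordOffset β t ^ 2 := by positivity
  have hL0 := sqrt_pos.2 hL
  have hκ := chordOffset_mem_Ioo hβ h0 h1
  have hκ2 : chordOffset β t ^ 2 < capSin β ^ 2 := sq_lt_sq' hκ.1 hκ.2
  rw [mFun_div_sqrt_eq hβ h0 h1, mem_Ioo, ← abs_lt, ← sq_lt_one_iff_abs_lt_one, div_pow, mul_pow,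
    sq_sqrt hL.le, div_lt_one (by positivity)]
  nlinarith [capCos_sq_add_capSin_sq β, mul_lt_mul_of_pos_left hκ2 (pow_pos hc 2)]

theorem cos_digonAngle : cos (digonAngle β t) = mFun β t / √(nFun β t * (2 - nFun β t)) := by
  have := mFun_div_sqrt_mem_Ioo hβ h0 h1
  exact cos_arccos this.1.le this.2.le

/-- Here `n' = m` and `1 - (1 - n)² = n(2 - n)`; `0 < n < 2` keeps the argument away from the
singularities of `arccos`. -/
theorem hasDerivAt_arccos_one_sub_nFun :
    HasDerivAt (fun t => arccos (1 - nFun β t)) (cos (digonAngle β t)) t := by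
  have hω := sqrt_one_add_sq_pos β
  have hω2 : √(1 + β ^ 2) ^ 2 = 1 + β ^ 2 := sq_sqrt (by positivity)
  have hsin := sin_half_angle_pos h0 h1
  have hs := capSin_pos β
  have hc := capCos_pos hβ
  have hn0 : 0 < nFun β t := by rw [nFun_eq]; positivity
  have hn2 : nFun β t < 2 := by
    have := capCos_sq_add_chordOffset_sq β t
    have : 0 < capCos β ^ 2 + chordOffset β t ^ 2 := by positivity
    rw [nFun_eq]; linarith
  have hn : HasDerivAt (nFun β) (mFun β t) t := by
    have := ((((hasDerivAt_id t).mul_const √(1 + β ^ 2)).cos).const_sub 1).div_const (1 + β ^ 2)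
    convert! this using 1
    simp only [id, mFun]
    generalize √(1 + β ^ 2) = ω at *
    rw [← hω2]; field_simp
  have h := (hasDerivAt_arccos (x := 1 - nFun β t) (by linarith) (by linarith)).comp t
    (hn.const_sub 1)
  convert! h using 1
  rw [cos_digonAngle hβ h0 h1, show nFun β t * (2 - nFun β t) = 1 - (1 - nFun β t) ^ 2 by ring]
  ring

theorem hasDerivAt_digonAngle : HasDerivAt (digonAngle β)
    (|β| / (2 * (capCos β ^ 2 + chordOffset β t ^ 2))) t := by
  have hω := sqrt_one_add_sq_pos β
  have hs := capSin_pos β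
  have hc := capCos_pos hβ
  have hcs := capCos_sq_add_capSin_sq β
  have hsin := sin_half_angle_pos h0 h1
  have hκ := chordOffset_mem_Ioo hβ h0 h1
  have hX : (chordOffset β t / capCos β) ^ 2 < (capSin β / capCos β) ^ 2 := by
    rw [div_pow, div_pow]
    exact div_lt_div_of_pos_right (sq_lt_sq' hκ.1 hκ.2) (by positivity)
  have hd : HasDerivAt (fun t => chordOffset β t / capCos β)
      (-(capSin β * sin (t * √(1 + β ^ 2) / 2) * (√(1 + β ^ 2) / 2) / capCos β)) t := by
    have := (((((hasDerivAt_id t).mul_const √(1 + β ^ 2)).div_const 2).cos).const_mul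
      (capSin β)).div_const (capCos β)
    convert! this using 1
    simp only [id]; ring
  have h := (hasDerivAt_arccos_gnomonic hc hs hcs hX).comp t hd
  have heq : digonAngle β =ᶠ[𝓝 t] (fun X => arccos (X / (capSin β * √(1 + X ^ 2)))) ∘
      (fun t => chordOffset β t / capCos β) := by
    filter_upwards [Ioo_mem_nhds h0 h1] with x hx
    rw [digonAngle_eq hβ hx.1 hx.2, div_mul_sqrt_eq_gnomonic hc]
    rfl
  refine (h.congr_of_eventuallyEq heq).congr_deriv ?_
  -- The half-length of the gnomonic chord is `s sin h / c`, with `sin h > 0` fixing the sign of the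
  -- root.
  have hR : √((capSin β / capCos β) ^ 2 - (chordOffset β t / capCos β) ^ 2) =
      capSin β * sin (t * √(1 + β ^ 2) / 2) / capCos β := by
    rw [← sqrt_sq (show 0 ≤ capSin β * sin (t * √(1 + β ^ 2) / 2) / capCos β by positivity)]
    congr 1
    rw [chordOffset]
    field_simp
    linear_combination (-1) * sin_sq_add_cos_sq (t * √(1 + β ^ 2) / 2)
  rw [hR, ← capCos_mul_sqrt]
  field_simp

/-- `2ψ' = |β|/(c² + κ²)`, and `c² + κ² < 1` as long as the end points of the arc differ. -/
theorem exists_pos_hasDerivAt_area :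
    ∃ S', 0 < S' ∧ HasDerivAt (fun t => 2 * digonAngle β t - |β| * t) S' t := by
  have hc := capCos_pos hβ
  have hL : 0 < capCos β ^ 2 + chordOffset β t ^ 2 := by positivity
  have h := ((hasDerivAt_digonAngle hβ h0 h1).const_mul 2).sub
    ((hasDerivAt_id t).const_mul |β|)
  refine ⟨_, ?_, h⟩
  have hlt := capCos_sq_add_chordOffset_sq_lt_one h0 h1
  have hb := abs_pos.2 hβ
  have : |β| < 2 * (|β| / (2 * (capCos β ^ 2 + chordOffset β t ^ 2))) := by
    rw [← mul_div_assoc, mul_div_mul_left _ _ two_ne_zero, lt_div_iff₀ hL]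
    nlinarith
  linarith

end

/-- At `t = 0` the quotient in `digonAngle` is `0/0`, with default value 0 and angle `π/2`, so the
limit is not the value there. The form `κ/(sL)` is continuous and equals 1 at 0. -/
theorem tendsto_digonAngle {β : ℝ} (hβ : β ≠ 0) : Tendsto (digonAngle β) (𝓝[>] 0) (𝓝 0) := by
  have hω := sqrt_one_add_sq_pos β
  have hs := capSin_pos β
  have hc := capCos_pos hβ
  have hcont : Continuous fun t => arccos (chordOffset β t /
      (capSin β * √(capCos β ^ 2 + chordOffset β t ^ 2))) := by
    have hκ : Continuous (chordOffset β) := by unfold chordOffset; fun_prop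
    refine continuous_arccos.comp (hκ.div (by fun_prop) fun t => ?_)
    have : 0 < √(capCos β ^ 2 + chordOffset β t ^ 2) := sqrt_pos.2 (by positivity)
    positivity
  have h := (hcont.tendsto 0).mono_left (nhdsWithin_le_nhds (s := Ioi 0))
  have hκ0 : chordOffset β 0 = capSin β := by simp [chordOffset]
  rw [hκ0, capCos_sq_add_capSin_sq, sqrt_one, mul_one, div_self hs.ne', arccos_one] at h
  refine h.congr' ?_
  filter_upwards [Ioo_mem_nhdsGT (show 0 < 2 * π / √(1 + β ^ 2) by positivity)] with x hx
  exact (digonAngle_eq hβ hx.1 hx.2).symm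

theorem tendsto_area {β : ℝ} (hβ : β ≠ 0) :
    Tendsto (fun t => 2 * digonAngle β t - |β| * t) (𝓝[>] 0) (𝓝 0) := by
  have h1 : Tendsto (fun t : ℝ => |β| * t) (𝓝[>] 0) (𝓝 (|β| * 0)) :=
    (Continuous.tendsto (by fun_prop) 0).mono_left nhdsWithin_le_nhds
  simpa using ((tendsto_digonAngle hβ).const_mul 2).sub h1

/-- Needed because `ENNReal.ofReal` truncates negative numbers. The function is increasing with
limit 0 at `0⁺`. -/
theorem area_nonneg {β t : ℝ} (hβ : β ≠ 0) (h0 : 0 < t) (h1 : t < 2 * π / √(1 + β ^ 2)) :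
    0 ≤ 2 * digonAngle β t - |β| * t := by
  have hmono : MonotoneOn (fun t => 2 * digonAngle β t - |β| * t)
      (Ioo 0 (2 * π / √(1 + β ^ 2))) := by
    have hd := fun x (hx : x ∈ Ioo 0 (2 * π / √(1 + β ^ 2))) =>
      exists_pos_hasDerivAt_area hβ hx.1 hx.2
    refine monotoneOn_of_deriv_nonneg (convex_Ioo _ _) ?_ ?_ ?_
    · intro x hx
      obtain ⟨_, -, h⟩ := hd x hx
      exact h.continuousAt.continuousWithinAt
    · intro x hx
      obtain ⟨_, -, h⟩ := hd x (interior_subset hx)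
      exact h.differentiableAt.differentiableWithinAt
    · intro x hx
      obtain ⟨_, hp, h⟩ := hd x (interior_subset hx)
      rw [h.deriv]; exact hp.le
  refine le_of_tendsto (tendsto_area hβ) ?_
  filter_upwards [Ioo_mem_nhdsGT h0] with x hx
  exact hmono ⟨hx.1, hx.2.trans h1⟩ ⟨h0, h1⟩ hx.2.le

/-- At `t = 2π/ω` the curve is back at `x(0)`. Before that, the first two coordinates determine
`cos(tω)` and `sin(tω)`, hence `t`. -/
theorem injOn_projGeo_iff {β t₁ : ℝ} (h0 : 0 ≤ t₁) :
    InjOn (projGeo β) (Icc 0 t₁) ↔ t₁ < 2 * π / √(1 + β ^ 2) := by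
  have hω := sqrt_one_add_sq_pos β
  constructor
  · intro h
    by_contra! hle
    have hT : 0 < 2 * π / √(1 + β ^ 2) := by positivity
    have := h ⟨hT.le, hle⟩ ⟨le_rfl, h0⟩ (by
      rw [projGeo_eq, projGeo_eq, nFun, nFun, mFun, mFun, div_mul_cancel₀ _ hω.ne']; simp)
    exact hT.ne' this
  · intro hlt x hx y hy hxy
    rw [projGeo_eq, projGeo_eq] at hxy
    have e0 := congrArg (fun v : E3 => v 0) hxy
    have e1 := congrArg (fun v : E3 => v 1) hxy
    simp only [Matrix.cons_val_zero, Matrix.cons_val_one] at e0 e1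
    rw [nFun, nFun, sub_right_inj, div_left_inj' (by positivity), sub_right_inj] at e0
    rw [mFun, mFun, div_left_inj' hω.ne'] at e1
    have hc : cos (x * √(1 + β ^ 2) - y * √(1 + β ^ 2)) = 1 := by
      rw [cos_sub, e0, e1]; linarith [sin_sq_add_cos_sq (y * √(1 + β ^ 2))]
    rw [lt_div_iff₀ hω] at hlt
    have hx1 := mul_le_mul_of_nonneg_right hx.2 hω.le
    have hy1 := mul_le_mul_of_nonneg_right hy.2 hω.le
    have hx0 := mul_nonneg hx.1 hω.le
    have hy0 := mul_nonneg hy.1 hω.le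
    have := (cos_eq_one_iff_of_lt_of_lt (by linarith) (by linarith)).1 hc
    exact mul_right_cancel₀ hω.ne' (sub_eq_zero.1 this)

/-- The chord joining the end points of the arc and the digon it cuts off. -/
theorem exists_frame_digon {β t₁ : ℝ} (hβ : β ≠ 0) (h0 : 0 ≤ t₁)
    (h1 : t₁ < 2 * π / √(1 + β ^ 2)) :
    ∃ b : OrthonormalBasis (Fin 3) ℝ E3,
      (∀ K l, IsShortestSegment (projGeo β 0) (projGeo β t₁) K l ↔
        K = capChord b (capCos β) (chordOffset β t₁) ∧ l = arccos (1 - nFun β t₁)) ∧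
      projGeo β '' Icc 0 t₁ ∪ capChord b (capCos β) (chordOffset β t₁) =
        closedDigon b (capCos β) (chordOffset β t₁) \ openDigon b (capCos β) (chordOffset β t₁) ∧
      ∀ t, t = 0 ∨ t = t₁ → inner ℝ (b 0) (projGeo β t) = capCos β ∧
        chordOffset β t₁ * inner ℝ (b 0) (projGeo β t) =
          capCos β * inner ℝ (b 1) (projGeo β t) := by
  have hω := sqrt_one_add_sq_pos β
  have hs := capSin_pos β
  have hc := capCos_pos hβ
  have hcs := capCos_sq_add_capSin_sq β
  have hπ := (half_angle_lt_pi_iff β t₁).2 h1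
  have hκ : chordOffset β t₁ = capSin β * cos (t₁ * √(1 + β ^ 2) / 2) := rfl
  have hn := nFun_eq β t₁
  rw [hκ]
  set h := t₁ * √(1 + β ^ 2) / 2 with hh
  have hh0 : 0 ≤ h := by positivity
  -- The frame depends on `t₁`: turned by `h`, it places the arc symmetrically at `-h ≤ φ ≤ h`.
  obtain ⟨b, hb⟩ := exists_frame hβ h
  have hb' : ∀ t, projGeo β t = smallCircle b (capCos β) (capSin β) (t * √(1 + β ^ 2) - h) := hb
  have e0 : projGeo β 0 = smallCircle b (capCos β) (capSin β) (-h) := by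
    rw [hb', zero_mul, zero_sub]
  have e1 : projGeo β t₁ = smallCircle b (capCos β) (capSin β) h := by
    rw [hb']; congr 1; rw [hh]; ring
  refine ⟨b, ?_, ?_, ?_⟩
  · intro K l
    obtain ⟨k, w, d, hk, hw, hkw, hd0, hd, hcosd, g0, g1, gim⟩ :=
      exists_greatCircle_eq b hc hs hcs hh0 hπ
    have hl : arccos (1 - nFun β t₁) = 2 * d := by
      rw [hn, show 1 - 2 * capSin β ^ 2 * sin h ^ 2 = cos (2 * d) by
        rw [Real.cos_two_mul, hcosd]; ring]
      exact arccos_cos (by linarith) (by linarith)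
    rw [e0, e1, ← g0, ← g1, isShortestSegment_greatCircle_iff hk hw hkw hd0 hd, gim, hl]
  · have : projGeo β '' Icc 0 t₁ = smallCircle b (capCos β) (capSin β) '' Icc (-h) h := by
      have himg : (fun t => t * √(1 + β ^ 2) - h) '' Icc 0 t₁ = Icc (-h) h := by
        ext φ
        constructor
        · rintro ⟨t, ht, rfl⟩
          have := mul_nonneg ht.1 hω.le
          have := mul_le_mul_of_nonneg_right ht.2 hω.le
          constructor <;> linarith
        · rintro ⟨h2, h3⟩
          refine ⟨(φ + h) / √(1 + β ^ 2), ⟨div_nonneg (by linarith) hω.le, ?_⟩, ?_⟩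
          · rw [div_le_iff₀ hω]; linarith
          · simp only; rw [div_mul_cancel₀ _ hω.ne']; ring
      rw [← himg, image_image]
      exact image_congr fun t _ => hb' t
    rw [this, smallCircle_union_capChord b hc hs hcs hh0 hπ]
  · have key : ∀ φ, cos φ = cos h → inner ℝ (b 0) (smallCircle b (capCos β) (capSin β) φ) =
        capCos β ∧ capSin β * cos h * inner ℝ (b 0) (smallCircle b (capCos β) (capSin β) φ) =
          capCos β * inner ℝ (b 1) (smallCircle b (capCos β) (capSin β) φ) := by
      intro φ hφ
      rw [smallCircle_eq, inner_coord_zero, inner_coord_one, hφ]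
      exact ⟨rfl, mul_comm _ _⟩
    rintro t (rfl | rfl)
    · rw [e0]; exact key _ (cos_neg h)
    · rw [e1]; exact key _ rfl

/-! ### Assembly of the result. -/

theorem proposition3 (β : ℝ) (hβ : β ≠ 0) :
    -- the arc has no self-intersection exactly if `t₁ < 2π/√(1+β²)`
    (∀ t₁ : ℝ, 0 ≤ t₁ →
      (InjOn (projGeo β) (Icc 0 t₁) ↔ t₁ < 2 * π / √(1 + β ^ 2))) ∧
    -- the shortest segment and the lesser digon exist and are unique
    (∀ t₁ : ℝ, 0 ≤ t₁ → t₁ < 2 * π / √(1 + β ^ 2) →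
      ∃! K : Set E3, ∃ l : ℝ, IsShortestSegment (projGeo β 0) (projGeo β t₁) K l) ∧
    (∀ t₁ : ℝ, 0 < t₁ → t₁ < 2 * π / √(1 + β ^ 2) →
      ∃! P : Set E3, IsLesserDigon β t₁ P) ∧
    ∃ r ψ S : ℝ → ℝ,
      -- `r` is the length of the shortest segment, `ψ` the interior angle of the digon (at both
      -- vertices), `S` its area
      (∀ t₁ : ℝ, 0 ≤ t₁ → t₁ < 2 * π / √(1 + β ^ 2) →
        ∀ (K : Set E3) (l : ℝ), IsShortestSegment (projGeo β 0) (projGeo β t₁) K l → l = r t₁) ∧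
      (∀ t₁ : ℝ, 0 < t₁ → t₁ < 2 * π / √(1 + β ^ 2) →
        ∀ P : Set E3, IsLesserDigon β t₁ P →
          HasInteriorAngle P (projGeo β 0) (ψ t₁) ∧
          HasInteriorAngle P (projGeo β t₁) (ψ t₁) ∧
          0 ≤ S t₁ ∧ sphereArea P = ENNReal.ofReal (S t₁)) ∧
      -- the formulas
      (∀ t₁ : ℝ, 0 ≤ t₁ → t₁ < 2 * π / √(1 + β ^ 2) → r t₁ = arccos (1 - nFun β t₁)) ∧
      (∀ t₁ : ℝ, 0 < t₁ → t₁ < 2 * π / √(1 + β ^ 2) →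
        HasDerivAt r (cos (ψ t₁)) t₁ ∧
        cos (ψ t₁) = mFun β t₁ / √(nFun β t₁ * (2 - nFun β t₁)) ∧
        S t₁ = 2 * ψ t₁ - |β| * t₁ ∧
        DifferentiableAt ℝ S t₁ ∧ 0 < deriv S t₁) ∧
      -- the degenerate case `t₁ = 0`, as a limit
      Tendsto ψ (𝓝[>] 0) (𝓝 0) ∧ Tendsto S (𝓝[>] 0) (𝓝 0) ∧
      -- the ranges of the angle
      (∀ t₁ : ℝ, 0 < t₁ → t₁ ≤ π / √(1 + β ^ 2) → 0 < ψ t₁ ∧ ψ t₁ ≤ π / 2) ∧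
      (∀ t₁ : ℝ, π / √(1 + β ^ 2) < t₁ → t₁ < 2 * π / √(1 + β ^ 2) →
        π / 2 < ψ t₁ ∧ ψ t₁ < π) := by
  have digon_iff : ∀ t₁ : ℝ, 0 < t₁ → t₁ < 2 * π / √(1 + β ^ 2) →
      ∃ b : OrthonormalBasis (Fin 3) ℝ E3,
        (∀ P, IsLesserDigon β t₁ P ↔ P = openDigon b (capCos β) (chordOffset β t₁)) ∧
        ∀ t, t = 0 ∨ t = t₁ → HasInteriorAngle (openDigon b (capCos β) (chordOffset β t₁))
          (projGeo β t) (digonAngle β t₁) := by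
    intro t₁ h0 h1
    have hs := capSin_pos β
    have hc := capCos_pos hβ
    have hcs := capCos_sq_add_capSin_sq β
    obtain ⟨b, hseg, hcurve, hvert⟩ := exists_frame_digon hβ h0.le h1
    refine ⟨b, fun P => ?_, fun t ht => ?_⟩
    · rw [← isLesserRegion_iff b hc hs hcs (chordOffset_mem_Ioo hβ h0 h1), ← hcurve]
      constructor
      · rintro ⟨K, l, hK, hP⟩
        -- Uniqueness of the shortest segment removes the choice of `K` in the definition of the
        -- digon.
        rwa [((hseg K l).1 hK).1] at hP
      · exact fun hP => ⟨_, _, (hseg _ _).2 ⟨rfl, rfl⟩, hP⟩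
    · rw [digonAngle_eq hβ h0 h1]
      exact hasInteriorAngle_openDigon b hc hs hcs (hvert t ht).1 (hvert t ht).2
  have hω := sqrt_one_add_sq_pos β
  refine ⟨fun t₁ h0 => injOn_projGeo_iff h0, ?_, ?_, fun t => arccos (1 - nFun β t),
    digonAngle β, fun t => 2 * digonAngle β t - |β| * t, ?_, ?_, fun _ _ _ => rfl, ?_,
    tendsto_digonAngle hβ, tendsto_area hβ, ?_, ?_⟩
  · intro t₁ h0 h1
    obtain ⟨b, hseg, -⟩ := exists_frame_digon hβ h0 h1
    exact ⟨_, ⟨_, (hseg _ _).2 ⟨rfl, rfl⟩⟩, fun K ⟨l, hK⟩ => ((hseg K l).1 hK).1⟩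
  · intro t₁ h0 h1
    obtain ⟨b, hb, -⟩ := digon_iff t₁ h0 h1
    exact ⟨_, (hb _).2 rfl, fun P hP => (hb P).1 hP⟩
  · intro t₁ h0 h1 K l hK
    obtain ⟨b, hseg, -⟩ := exists_frame_digon hβ h0 h1
    exact ((hseg K l).1 hK).2
  · intro t₁ h0 h1 P hP
    obtain ⟨b, hb, hangle⟩ := digon_iff t₁ h0 h1
    rw [(hb P).1 hP]
    refine ⟨hangle 0 (Or.inl rfl), hangle t₁ (Or.inr rfl), area_nonneg hβ h0 h1, ?_⟩
    -- `arccos(κ/s) = h` since `0 ≤ h ≤ π`, and `2ch = cωt₁ = |β|t₁`.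
    rw [sphereArea_openDigon b (capCos_pos hβ) (capSin_pos β) (capCos_sq_add_capSin_sq β)
      (chordOffset_mem_Ioo hβ h0 h1), ← digonAngle_eq hβ h0 h1, chordOffset,
      mul_div_cancel_left₀ _ (capSin_pos β).ne',
      arccos_cos (by positivity) ((half_angle_lt_pi_iff β t₁).2 h1).le, ← capCos_mul_sqrt]
    congr 1; ring
  · intro t₁ h0 h1
    obtain ⟨S', hpos, hS⟩ := exists_pos_hasDerivAt_area hβ h0 h1
    exact ⟨hasDerivAt_arccos_one_sub_nFun hβ h0 h1, cos_digonAngle hβ h0 h1, rfl,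
      hS.differentiableAt, by rwa [hS.deriv]⟩
  · intro t₁ h0 h1
    have h2 : t₁ < 2 * π / √(1 + β ^ 2) := h1.trans_lt (by gcongr; linarith [pi_pos])
    refine ⟨arccos_pos.2 (mFun_div_sqrt_mem_Ioo hβ h0 h2).2, arccos_le_pi_div_two.2 ?_⟩
    rw [le_div_iff₀ hω] at h1
    exact div_nonneg (div_nonneg (sin_nonneg_of_nonneg_of_le_pi (by positivity) h1) hω.le)
      (sqrt_nonneg _)
  · intro t₁ h1 h2
    have h0 : 0 < t₁ := lt_trans (by positivity) h1
    refine ⟨?_, arccos_lt_pi.2 (mFun_div_sqrt_mem_Ioo hβ h0 h2).1⟩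
    -- In this form the cosine of the angle has the sign of `cos h`, which is negative for `π/2 < h
    -- < π`.
    rw [digonAngle, mFun_div_sqrt_eq hβ h0 h2]
    refine lt_of_not_ge fun h => absurd (arccos_le_pi_div_two.1 h) (not_le.2 ?_)
    have hs := capSin_pos β
    have hc := capCos_pos hβ
    have hL : 0 < √(capCos β ^ 2 + chordOffset β t₁ ^ 2) := sqrt_pos.2 (by positivity)
    refine div_neg_of_neg_of_pos (mul_neg_of_pos_of_neg hs ?_) (mul_pos hs hL)
    rw [div_lt_iff₀ hω] at h1
    rw [lt_div_iff₀ hω] at h2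
    exact cos_neg_of_pi_div_two_lt_of_lt (by linarith) (by linarith)
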